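/- Let $W(x)=\frac12(x^2-1)^2$ for $x\in\mathbb R$ and, for $\beta\ge 1$, let $H_\beta$ be the self-adjoint operator on $L^2(\mathbb R)$ that has $C^2_c(\mathbb R)$ as a core and is given there by $H_\beta=-\frac1{2\beta}\frac{d^2}{dx^2}+\beta W$. Let $E_0=E_{0,\beta}$ and $E_1=E_{1,\beta}$ be its first two eigenvalues, enumerated in increasing order with multiplicity, and let $\psi_0=\psi_{0,\beta}$, $\psi_1=\psi_{1,\beta}$ be the (continuous representatives of the) corresponding orthonormal eigenfunctions, with signs chosen so that $\psi_0>0$ on $\mathbb R$ and $\psi_1>0$ on $(0,\infty)$. Then: (a) There exists a constant $C\in(0,\infty)$ such that, for every $\beta\ge1$, $$\sup_{x\ge0}\ \psi_0(x)\,\bigl|\psi_0(x)-\psi_1(x)\bigr|\le C\,\beta^{3/2}\,(E_1-E_0).$$ (b) Let $\bar\chi\in C^\infty(\mathbb R)$ satisfy $0\le\bar\chi\le1$, $\bar\chi=1$ on $(-\infty,-2]$ and $\bar\chi=0$ on $[-1,\infty)$, let $c>0$, and set $$\kappa_\beta:=\left(\int_0^1\frac{\bar\chi\bigl(\delta_\beta^{-1}(|y|-1)\bigr)}{\psi_{0,\beta}(y)^2}\,dy\right)^{-1},\qquad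 \delta_\beta=c\,\beta^{-1/2}.$$ Then $\beta\,(E_{1,\beta}-E_{0,\beta})\sim\kappa_\beta$ as $\beta\to\infty$, that is, the quotient of the two sides tends to $1$. -/

import Mathlib

open MeasureTheory Filter Asymptotics

open scoped ContDiff

noncomputable section

namespace DoubleWell

/-- The quartic double well potential `W x = (x² - 1)² / 2`. -/
def W (x : ℝ) : ℝ := (x ^ 2 - 1) ^ 2 / 2

/-- The real Hilbert space `L²(ℝ)` with respect to Lebesgue measure. -/
abbrev L2 : Type := Lp ℝ 2 (volume : Measure ℝ)

/-- The space `C²_c(ℝ)` of compactly supported functions of class `C²`. -/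
def Cc2 : Submodule ℝ (ℝ → ℝ) where
  carrier := {u | ContDiff ℝ 2 u ∧ HasCompactSupport u}
  zero_mem' := ⟨contDiff_const, HasCompactSupport.zero⟩
  add_mem' hu hv := ⟨hu.1.add hv.1, hu.2.add hv.2⟩
  smul_mem' c _ hu := ⟨contDiff_const.smul hu.1, hu.2.smul_left (f := fun _ => c)⟩

/-- The differential expression `-(1/(2β)) u'' + β W u`. -/
def schrodinger (β : ℝ) (u : ℝ → ℝ) (x : ℝ) : ℝ :=
  -(1 / (2 * β)) * deriv (deriv u) x + β * W x * u x

lemma memLp_Cc2 (u : Cc2) : MemLp (u : ℝ → ℝ) 2 volume :=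
  u.2.1.continuous.memLp_of_hasCompactSupport u.2.2

lemma contDiff_deriv_Cc2 (u : Cc2) : ContDiff ℝ 1 (deriv (u : ℝ → ℝ)) :=
  (contDiff_succ_iff_deriv (n := 1).1 (by simpa [one_add_one_eq_two] using u.2.1)).2.2

lemma memLp_schrodinger_Cc2 (β : ℝ) (u : Cc2) :
    MemLp (schrodinger β (u : ℝ → ℝ)) 2 volume := by
  have h1 : Continuous (deriv (deriv (u : ℝ → ℝ))) := (contDiff_deriv_Cc2 u).continuous_deriv le_rfl
  have h2 : Continuous (u : ℝ → ℝ) := u.2.1.continuous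
  have h3 : Continuous W := by unfold W; fun_prop
  refine Continuous.memLp_of_hasCompactSupport (by unfold schrodinger; fun_prop) ?_
  exact (u.2.2.deriv.deriv.mul_left (f := fun _ => -(1 / (2 * β)))).add
    (u.2.2.mul_left (f := fun x => β * W x))

/-- The inclusion of `C²_c(ℝ)` in `L²(ℝ)`. -/
def incl : Cc2 →ₗ[ℝ] L2 where
  toFun u := (memLp_Cc2 u).toLp
  map_add' _ _ := rfl
  map_smul' _ _ := rfl

lemma incl_injective : Function.Injective incl := by
  intro u v h
  have h' : (u : ℝ → ℝ) =ᵐ[volume] v := (MemLp.toLp_eq_toLp_iff (memLp_Cc2 u) (memLp_Cc2 v)).1 h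
  exact Subtype.ext ((u.2.1.continuous.ae_eq_iff_eq volume v.2.1.continuous).1 h')

/-- The differential expression as a linear map from `C²_c(ℝ)` to `L²(ℝ)`. -/
def schrodingerLp (β : ℝ) : Cc2 →ₗ[ℝ] L2 where
  toFun u := (memLp_schrodinger_Cc2 β u).toLp
  map_add' u v := by
    rw [← MemLp.toLp_add]
    congr 1
    funext x
    have hu : deriv ((u : ℝ → ℝ) + (v : ℝ → ℝ)) = deriv (u : ℝ → ℝ) + deriv (v : ℝ → ℝ) :=
      funext fun y => deriv_add (u.2.1.differentiable (by norm_num) y)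
        (v.2.1.differentiable (by norm_num) y)
    have hd : deriv (deriv (u : ℝ → ℝ) + deriv (v : ℝ → ℝ)) x
        = deriv (deriv (u : ℝ → ℝ)) x + deriv (deriv (v : ℝ → ℝ)) x :=
      deriv_add ((contDiff_deriv_Cc2 u).differentiable (by norm_num) x)
        ((contDiff_deriv_Cc2 v).differentiable (by norm_num) x)
    simp only [schrodinger, Submodule.coe_add, hu, hd, Pi.add_apply]
    ring
  map_smul' c u := by
    rw [RingHom.id_apply, ← MemLp.toLp_const_smul]
    congr 1
    funext x
    have hu : deriv (c • (u : ℝ → ℝ)) = c • deriv (u : ℝ → ℝ) :=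
      funext fun y => deriv_const_smul c (u.2.1.differentiable (by norm_num) y)
    have hd : deriv (c • deriv (u : ℝ → ℝ)) x = c • deriv (deriv (u : ℝ → ℝ)) x :=
      deriv_const_smul c ((contDiff_deriv_Cc2 u).differentiable (by norm_num) x)
    simp only [schrodinger, Submodule.coe_smul, hu, hd, Pi.smul_apply, smul_eq_mul]
    ring

/-- The operator `-(1/(2β)) d²/dx² + β W` in `L²(ℝ)` with domain `C²_c(ℝ)`. -/
def minimalOperator (β : ℝ) : L2 →ₗ.[ℝ] L2 where
  domain := LinearMap.range incl
  toFun := schrodingerLp β ∘ₗ (LinearEquiv.ofInjective incl incl_injective).symm.toLinearMap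

/-- The Schrödinger operator `H_β = -(1/(2β)) d²/dx² + β W` on `L²(ℝ)`: the self-adjoint operator
that has `C²_c(ℝ)` as a core, that is, the closure of its restriction to `C²_c(ℝ)`. -/
def H (β : ℝ) : L2 →ₗ.[ℝ] L2 := (minimalOperator β).closure

/-- `f` is an eigenvector of `H_β` for the eigenvalue `E`. -/
def IsEigenvector (β E : ℝ) (f : L2) : Prop :=
  f ≠ 0 ∧ ∃ hf : f ∈ (H β).domain, H β ⟨f, hf⟩ = E • f

/-- `E₀`, `E₁` are the first two eigenvalues of `H_β`, enumerated in increasing order with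
multiplicity, and `ψ₀`, `ψ₁` are (the continuous representatives of) corresponding orthonormal
eigenfunctions, with signs chosen so that `ψ₀` is positive and `ψ₁` is positive on the positive
half-line. -/
structure IsFirstTwoEigenpairs (β E₀ E₁ : ℝ) (ψ₀ ψ₁ : ℝ → ℝ) : Prop where
  continuous₀ : Continuous ψ₀
  continuous₁ : Continuous ψ₁
  memLp₀ : MemLp ψ₀ 2 volume
  memLp₁ : MemLp ψ₁ 2 volume
  eigen₀ : IsEigenvector β E₀ memLp₀.toLp
  eigen₁ : IsEigenvector β E₁ memLp₁.toLp
  norm₀ : ‖memLp₀.toLp‖ = 1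
  norm₁ : ‖memLp₁.toLp‖ = 1
  orthogonal : inner ℝ memLp₀.toLp memLp₁.toLp = 0
  lowest : ∀ (E : ℝ) (f : L2), IsEigenvector β E f → E₀ ≤ E
  second : ∀ (E : ℝ) (f : L2), IsEigenvector β E f → inner ℝ memLp₀.toLp f = 0 → E₁ ≤ E
  pos₀ : ∀ x, 0 < ψ₀ x
  pos₁ : ∀ x, 0 < x → 0 < ψ₁ x

/-- A smooth profile with values in `[0, 1]`, equal to `1` on `(-∞, -2]` and to `0` on
`[-1, ∞)`. -/
structure IsCutoffProfile (χ : ℝ → ℝ) : Prop where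
  smooth : ContDiff ℝ ∞ χ
  nonneg : ∀ x, 0 ≤ χ x
  le_one : ∀ x, χ x ≤ 1
  eq_one : ∀ x, x ≤ -2 → χ x = 1
  eq_zero : ∀ x, -1 ≤ x → χ x = 0

/-- `(∫₀¹ χ_δ(y) / ψ₀(y)² dy)⁻¹` with `χ_δ(y) = χ((|y| - 1) / δ)`. -/
def kappa (χ : ℝ → ℝ) (δ : ℝ) (ψ₀ : ℝ → ℝ) : ℝ :=
  (∫ y in (0 : ℝ)..1, χ ((|y| - 1) / δ) / ψ₀ y ^ 2)⁻¹

end DoubleWell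

end

open scoped Topology Interval

/-! ### Eigenvectors of the closed operator are classical solutions. -/

namespace DoubleWell

/-! Everything reduces to ordinary differential equations on the half-line. Eigenfunctions are
classical solutions, and comparison with their reflections shows that `ψ₀` is even and `ψ₁` odd, so
both carry mass `1/2` on `[0, ∞)`. Put `ε = β (E₁ - E₀)`, `r = ψ₁ / ψ₀` and let `w` be the
Wronskian. Then `r' = w / ψ₀²`, `w' = -2 ε ψ₀ ψ₁`, `r 0 = 0` and `w → 0` at infinity. Hence `w ≥ 0`
is decreasing, `r` is increasing, and `w x` is `2 ε` times the integral of `ψ₀ ψ₁` over `[x, ∞)`.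

For (a), `E₁ ≤ 6` gives decay uniform in `β`, hence `∫ w ≤ 4 ε`. Since `ψ₀` is unimodal on the
half-line with peak `m` (`exists_isPeak`), `ψ₀ x` is the minimum of `ψ₀` between `x` and `m`, so `ψ₀
x ^ 2 * |r x - r m| ≤ 4 ε` (`sq_mul_abs_sub_le`). The equal masses force `|1 - r m| ≤ 64 ε`
(`abs_one_sub_ratio_peak_le`), and `ψ₀ m ^ 2 ≤ 8 √β` (`peak_sq_le`) supplies the remaining power of
`β`.

For (b), `ε → 0` (`mul_gap_le`), and `w 0 = ε (1 + O(ε))`. A Harnack inequality makes `ψ₀`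
comparable to its peak at distance `O(β^(-1/2))` from the well, so `r = 1 + O(ε)` there. The cutoff
integral of `w / ψ₀² = r'` is therefore close to `1`. Replacing `w y` by `w 0` in it costs only
`O(ε)`, which leaves `ε ∫ χ / ψ₀² → 1` (`gap_mul_integral_bounds`). -/

lemma mem_closure_graph_of_mem_graph_closure {f g : L2} {β : ℝ}
    (h : (f, g) ∈ (H β).graph) : (f, g) ∈ closure ((minimalOperator β).graph : Set (L2 × L2)) := by
  unfold H at h
  by_cases hc : (minimalOperator β).IsClosable
  · rw [← hc.graph_closure_eq_closure_graph] at h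
    exact h
  · rw [LinearPMap.closure_def' hc] at h
    exact subset_closure h

lemma exists_approx_of_isEigenvector {β E : ℝ} {f : L2} (hf : IsEigenvector β E f) :
    ∃ u : ℕ → Cc2, Tendsto (fun n => incl (u n)) atTop (𝓝 f) ∧
      Tendsto (fun n => schrodingerLp β (u n)) atTop (𝓝 (E • f)) := by
  obtain ⟨-, hd, hE⟩ := hf
  have hg : (f, E • f) ∈ (H β).graph := by
    rw [← hE]; exact (H β).mem_graph ⟨f, hd⟩
  obtain ⟨p, hp, hlim⟩ := mem_closure_iff_seq_limit.1 (mem_closure_graph_of_mem_graph_closure hg)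
  have hu : ∀ n, ∃ u : Cc2, incl u = (p n).1 ∧ schrodingerLp β u = (p n).2 := by
    intro n
    obtain ⟨⟨y, u, rfl⟩, hy1, hy2⟩ := (LinearPMap.mem_graph_iff _).1 (hp n)
    refine ⟨u, hy1, ?_⟩
    rw [← hy2]
    change _ = schrodingerLp β ((LinearEquiv.ofInjective incl incl_injective).symm _)
    congr 1
    exact ((LinearEquiv.ofInjective incl incl_injective).symm_apply_apply u).symm
  choose u hu1 hu2 using hu
  refine ⟨u, ?_, ?_⟩
  · simp only [hu1]; exact (continuous_fst.tendsto _).comp hlim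
  · simp only [hu2]; exact (continuous_snd.tendsto _).comp hlim

/-- `L²` convergence implies convergence of integrals over bounded intervals against continuous
weights. -/
lemma tendsto_intervalIntegral_mul_of_tendsto_L2 {g : ℕ → L2} {f : L2}
    (h : Tendsto g atTop (𝓝 f)) {k : ℝ → ℝ} (hk : Continuous k) (a b : ℝ) :
    Tendsto (fun n => ∫ y in a..b, k y * g n y) atTop (𝓝 (∫ y in a..b, k y * f y)) := by
  have key : ∀ a b : ℝ, Tendsto (fun n => ∫ y in Set.Ioc a b, k y * g n y) atTop
      (𝓝 (∫ y in Set.Ioc a b, k y * f y)) := by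
    intro a b
    have hm : MemLp ((Set.Ioc a b).indicator k) 2 volume := by
      rw [memLp_indicator_iff_restrict measurableSet_Ioc]
      refine MemLp.mono_measure (Measure.restrict_mono Set.Ioc_subset_Icc_self le_rfl) ?_
      obtain ⟨C, hC⟩ := isCompact_Icc.exists_bound_of_continuousOn (s := Set.Icc a b) hk.continuousOn
      exact MemLp.of_bound hk.aestronglyMeasurable C
        ((ae_restrict_iff' measurableSet_Icc).2 (ae_of_all _ hC))
    have e : ∀ v : L2, inner ℝ hm.toLp v = ∫ y in Set.Ioc a b, k y * v y := by
      intro v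
      rw [L2.inner_def, ← integral_indicator measurableSet_Ioc]
      refine integral_congr_ae ?_
      filter_upwards [hm.coeFn_toLp] with y hy
      rw [hy]
      by_cases hya : y ∈ Set.Ioc a b <;> simp [hya, mul_comm]
    simp only [← e]
    exact (continuous_const.inner continuous_id).tendsto f |>.comp h
  simp only [intervalIntegral]
  exact (key a b).sub (key b a)

lemma taylor_integral_Cc2 (u : Cc2) (a x : ℝ) :
    (u : ℝ → ℝ) x = (u : ℝ → ℝ) a + deriv (u : ℝ → ℝ) a * (x - a)
      + ∫ y in a..x, (x - y) * deriv (deriv (u : ℝ → ℝ)) y := by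
  have h1 : ∀ y, HasDerivAt (u : ℝ → ℝ) (deriv (u : ℝ → ℝ) y) y := fun y =>
    (u.2.1.differentiable (by norm_num) y).hasDerivAt
  have h2 : ∀ y, HasDerivAt (deriv (u : ℝ → ℝ)) (deriv (deriv (u : ℝ → ℝ)) y) y := fun y =>
    ((contDiff_deriv_Cc2 u).differentiable (by norm_num) y).hasDerivAt
  have h3 : Continuous (deriv (deriv (u : ℝ → ℝ))) := (contDiff_deriv_Cc2 u).continuous_deriv le_rfl
  have := intervalIntegral.integral_eq_sub_of_hasDerivAt (a := a) (b := x)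
    (f := fun y => (u : ℝ → ℝ) y + (x - y) * deriv (u : ℝ → ℝ) y)
    (f' := fun y => (x - y) * deriv (deriv (u : ℝ → ℝ)) y)
    (fun y _ => by
      have := (h1 y).add (((hasDerivAt_id y).const_sub x).mul (h2 y))
      refine this.congr_deriv ?_
      simp)
    ((by fun_prop : Continuous fun y => (x - y) * deriv (deriv (u : ℝ → ℝ)) y).intervalIntegrable _ _)
  rw [this]; ring

lemma continuous_W : Continuous W := by unfold W; fun_prop

/-- `ψ` is a classical solution, with derivative `dψ`, of `-(1/(2β)) ψ'' + β W ψ = E ψ`. -/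
structure IsSolution (β E : ℝ) (ψ dψ : ℝ → ℝ) : Prop where
  hasDerivAt : ∀ x, HasDerivAt ψ (dψ x) x
  hasDerivAt_deriv : ∀ x, HasDerivAt dψ (2 * β * (β * W x - E) * ψ x) x

/-- Continuous representatives of eigenvectors are classical solutions of the eigenvalue
equation. -/
lemma IsEigenvector.exists_isSolution {β E : ℝ} (hβ : 0 < β) {ψ : ℝ → ℝ} (hψ : Continuous ψ)
    (hL : MemLp ψ 2 volume) (he : IsEigenvector β E hL.toLp) : ∃ dψ, IsSolution β E ψ dψ := by
  obtain ⟨u, hu, hs⟩ := exists_approx_of_isEigenvector he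
  obtain ⟨φ, hφ, hae⟩ := (tendstoInMeasure_of_tendsto_Lp hu).exists_seq_tendsto_ae
  have hcoe : ∀ n, (incl (u n) : ℝ → ℝ) =ᵐ[volume] (u n : ℝ → ℝ) := fun n =>
    (memLp_Cc2 (u n)).coeFn_toLp
  have hcoes : ∀ n, (schrodingerLp β (u n) : ℝ → ℝ) =ᵐ[volume] schrodinger β (u n : ℝ → ℝ) :=
    fun n => (memLp_schrodinger_Cc2 β (u n)).coeFn_toLp
  have hae' : ∀ᵐ x, Tendsto (fun n => (u (φ n) : ℝ → ℝ) x) atTop (𝓝 (ψ x)) := by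
    filter_upwards [hae, ae_all_iff.2 hcoe, hL.coeFn_toLp] with x h1 h2 h3
    simpa only [h2, h3] using h1
  have hW := continuous_W
  -- the second derivatives converge weakly
  have hint : ∀ a x : ℝ, Tendsto
      (fun n => ∫ y in a..x, (x - y) * deriv (deriv (u (φ n) : ℝ → ℝ)) y) atTop
      (𝓝 (∫ y in a..x, (x - y) * (2 * β * (β * W y - E) * ψ y))) := by
    intro a x
    -- The second derivative is recovered as `u'' = 2β (β W u - H u)`, both terms of which converge
    -- in `L²`.
    have t1 := (tendsto_intervalIntegral_mul_of_tendsto_L2 hu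
      (k := fun y => (x - y) * (2 * β * (β * W y))) (by fun_prop) a x).comp hφ.tendsto_atTop
    have t2 := (tendsto_intervalIntegral_mul_of_tendsto_L2 hs
      (k := fun y => (x - y) * (2 * β)) (by fun_prop) a x).comp hφ.tendsto_atTop
    have t := t1.sub t2
    have e1 : (∫ y in a..x, (x - y) * (2 * β * (β * W y)) * (hL.toLp : L2) y)
        - (∫ y in a..x, (x - y) * (2 * β) * (E • (hL.toLp : L2) : L2) y)
        = ∫ y in a..x, (x - y) * (2 * β * (β * W y - E) * ψ y) := by
      rw [intervalIntegral.integral_congr_ae (g := fun y => (x - y) * (2 * β * (β * W y)) * ψ y),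
        intervalIntegral.integral_congr_ae (f := fun y => (x - y) * (2 * β) * (E • (hL.toLp : L2) : L2) y)
          (g := fun y => (x - y) * (2 * β) * (E * ψ y)), ← intervalIntegral.integral_sub]
      · refine intervalIntegral.integral_congr fun y _ => ?_
        ring
      · exact Continuous.intervalIntegrable (by fun_prop) _ _
      · exact Continuous.intervalIntegrable (by fun_prop) _ _
      · filter_upwards [hL.coeFn_toLp, Lp.coeFn_smul E hL.toLp] with y h1 h2 _
        rw [h2, Pi.smul_apply, h1, smul_eq_mul]
      · filter_upwards [hL.coeFn_toLp] with y h1 _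
        rw [h1]
    rw [e1] at t
    refine t.congr fun n => ?_
    have hc1 : Continuous (u (φ n) : ℝ → ℝ) := (u (φ n)).2.1.continuous
    have hc2 : Continuous (deriv (deriv (u (φ n) : ℝ → ℝ))) :=
      (contDiff_deriv_Cc2 (u (φ n))).continuous_deriv le_rfl
    have hc3 : Continuous (schrodinger β (u (φ n) : ℝ → ℝ)) := by unfold schrodinger; fun_prop
    simp only [Function.comp_apply]
    rw [intervalIntegral.integral_congr_ae
        (g := fun y => (x - y) * (2 * β * (β * W y)) * (u (φ n) : ℝ → ℝ) y),
      intervalIntegral.integral_congr_ae (f := fun y => (x - y) * (2 * β) * schrodingerLp β (u (φ n)) y)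
        (g := fun y => (x - y) * (2 * β) * schrodinger β (u (φ n) : ℝ → ℝ) y),
      ← intervalIntegral.integral_sub]
    · refine intervalIntegral.integral_congr fun y _ => ?_
      simp only [schrodinger]; field_simp; ring
    · exact Continuous.intervalIntegrable (by fun_prop) _ _
    · exact Continuous.intervalIntegrable (by fun_prop) _ _
    · filter_upwards [hcoes (φ n)] with y h1 _
      rw [h1]
    · filter_upwards [hcoe (φ n)] with y h1 _
      rw [h1]
  -- Pointwise convergence at two distinct points, together with convergence of the Taylor
  -- remainder, forces the slopes at `a` to converge.
  obtain ⟨a, ha⟩ := hae'.exists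
  obtain ⟨b, hb, hab⟩ : ∃ b, Tendsto (fun n => (u (φ n) : ℝ → ℝ) b) atTop (𝓝 (ψ b)) ∧ b ≠ a :=
    (hae'.and (Measure.ae_ne volume a)).exists
  have hba : b - a ≠ 0 := sub_ne_zero.2 hab
  obtain ⟨d, hd⟩ : ∃ d, Tendsto (fun n => deriv (u (φ n) : ℝ → ℝ) a) atTop (𝓝 d) := by
    refine ⟨_, (((hb.sub ha).sub (hint a b)).div_const (b - a)).congr fun n => ?_⟩
    rw [div_eq_iff hba]
    linarith [taylor_integral_Cc2 (u (φ n)) a b]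
  have hrep : ∀ᵐ x, ψ x = ψ a + d * (x - a)
      + ∫ y in a..x, (x - y) * (2 * β * (β * W y - E) * ψ y) := by
    filter_upwards [hae'] with x hx
    refine tendsto_nhds_unique hx (((ha.add (hd.mul_const (x - a))).add (hint a x)).congr fun n => ?_)
    exact (taylor_integral_Cc2 (u (φ n)) a x).symm
  set Q : ℝ → ℝ := fun y => 2 * β * (β * W y - E) * ψ y with hQ
  have hQc : Continuous Q := by fun_prop
  -- Taking `x` out of the integrand lets the fundamental theorem of calculus differentiate the
  -- right-hand side.
  have hsplit : ∀ x, (∫ y in a..x, (x - y) * Q y) = x * (∫ y in a..x, Q y) - ∫ y in a..x, y * Q y := by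
    intro x
    rw [← intervalIntegral.integral_const_mul, ← intervalIntegral.integral_sub]
    · refine intervalIntegral.integral_congr fun y _ => ?_
      ring
    · exact Continuous.intervalIntegrable (by fun_prop) _ _
    · exact Continuous.intervalIntegrable (by fun_prop) _ _
  have hder1 : ∀ x, HasDerivAt (fun x => ∫ y in a..x, Q y) (Q x) x := fun x =>
    hQc.integral_hasStrictDerivAt a x |>.hasDerivAt
  have hder2 : ∀ x, HasDerivAt (fun x => ∫ y in a..x, y * Q y) (x * Q x) x := fun x =>
    (by fun_prop : Continuous fun y => y * Q y).integral_hasStrictDerivAt a x |>.hasDerivAt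
  set F : ℝ → ℝ := fun x => ψ a + d * (x - a) + (x * (∫ y in a..x, Q y) - ∫ y in a..x, y * Q y)
  have hF : ∀ x, HasDerivAt F (d + ∫ y in a..x, Q y) x := by
    intro x
    have := ((((hasDerivAt_id x).sub_const a).const_mul d).const_add (ψ a)).add
      (((hasDerivAt_id x).mul (hder1 x)).sub (hder2 x))
    refine this.congr_deriv ?_
    simp
  have hFc : Continuous F := continuous_iff_continuousAt.2 fun x => (hF x).continuousAt
  have hψF : ψ = F := by
    refine (hψ.ae_eq_iff_eq volume hFc).1 ?_
    filter_upwards [hrep] with x hx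
    rw [hx, hsplit]
  refine ⟨fun x => d + ∫ y in a..x, Q y, ⟨fun x => ?_, fun x => (hder1 x).const_add d⟩⟩
  rw [hψF]; exact hF x

end DoubleWell

/-! ### Decay at infinity and parity of the eigenfunctions. -/

namespace DoubleWell

lemma monotoneOn_of_hasDerivAt_nonneg {f f' : ℝ → ℝ} {s : Set ℝ} (hs : Convex ℝ s)
    (hf : ∀ x ∈ s, HasDerivAt f (f' x) x) (h0 : ∀ x ∈ s, 0 ≤ f' x) : MonotoneOn f s :=
  monotoneOn_of_hasDerivWithinAt_nonneg hs (fun x hx => (hf x hx).continuousAt.continuousWithinAt)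
    (fun x hx => (hf x (interior_subset hx)).hasDerivWithinAt) fun x hx => h0 x (interior_subset hx)

lemma antitoneOn_of_hasDerivAt_nonpos {f f' : ℝ → ℝ} {s : Set ℝ} (hs : Convex ℝ s)
    (hf : ∀ x ∈ s, HasDerivAt f (f' x) x) (h0 : ∀ x ∈ s, f' x ≤ 0) : AntitoneOn f s :=
  antitoneOn_of_hasDerivWithinAt_nonpos hs (fun x hx => (hf x hx).continuousAt.continuousWithinAt)
    (fun x hx => (hf x (interior_subset hx)).hasDerivWithinAt) fun x hx => h0 x (interior_subset hx)

lemma hasDerivAt_integral_of_continuous {f : ℝ → ℝ} (hf : Continuous f) (a x : ℝ) :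
    HasDerivAt (fun x => ∫ y in a..x, f y) (f x) x :=
  (hf.integral_hasStrictDerivAt a x).hasDerivAt

namespace IsSolution

variable {β E E' R L : ℝ} {ψ dψ φ dφ : ℝ → ℝ}

lemma continuous (h : IsSolution β E ψ dψ) : Continuous ψ :=
  continuous_iff_continuousAt.2 fun x => (h.hasDerivAt x).continuousAt

lemma continuous_deriv (h : IsSolution β E ψ dψ) : Continuous dψ :=
  continuous_iff_continuousAt.2 fun x => (h.hasDerivAt_deriv x).continuousAt

lemma comp_neg (h : IsSolution β E ψ dψ) : IsSolution β E (fun x => ψ (-x)) fun x => -dψ (-x) where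
  hasDerivAt x := by
    have := (h.hasDerivAt (-x)).scomp x (hasDerivAt_neg x)
    simpa [Function.comp_def] using this
  hasDerivAt_deriv x := by
    have := ((h.hasDerivAt_deriv (-x)).scomp x (hasDerivAt_neg x)).fun_neg
    have hW : W (-x) = W x := by simp [W]
    simpa [Function.comp_def, hW] using this

lemma hasDerivAt_wronskian (h : IsSolution β E ψ dψ) (h' : IsSolution β E' φ dφ) (x : ℝ) :
    HasDerivAt (fun x => ψ x * dφ x - φ x * dψ x) (-(2 * β * (E' - E)) * (ψ x * φ x)) x := by
  refine (((h.hasDerivAt x).mul (h'.hasDerivAt_deriv x)).sub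
    ((h'.hasDerivAt x).mul (h.hasDerivAt_deriv x))).congr_deriv ?_
  ring

lemma hasDerivAt_mul_deriv (h : IsSolution β E ψ dψ) (x : ℝ) :
    HasDerivAt (fun x => ψ x * dψ x) (dψ x ^ 2 + 2 * β * (β * W x - E) * ψ x ^ 2) x := by
  refine ((h.hasDerivAt x).mul (h.hasDerivAt_deriv x)).congr_deriv ?_
  ring

lemma tendsto_integral_unit (h : IsSolution β E ψ dψ)
    (hI : Tendsto (fun x => ∫ t in (0 : ℝ)..x, ψ t ^ 2) atTop (𝓝 L)) :
    Tendsto (fun x => ∫ t in (x - 1)..x, ψ t ^ 2) atTop (𝓝 0) := by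
  have h1 := hI.sub (hI.comp (tendsto_atTop_add_const_right atTop (-1 : ℝ) tendsto_id))
  rw [sub_self] at h1
  refine h1.congr fun x => ?_
  have hc : Continuous fun t => ψ t ^ 2 := h.continuous.pow 2
  simp only [Function.comp_apply, id, ← sub_eq_add_neg]
  rw [intervalIntegral.integral_interval_sub_left] <;> exact hc.intervalIntegrable _ _

/-- In the forbidden region `ψ ψ'` is nondecreasing. Were it positive at `x`, then `ψ²` would grow
from `x` on, although the mass of unit intervals tends to `0`. -/
lemma mul_deriv_nonpos (h : IsSolution β E ψ dψ)
    (hI : Tendsto (fun x => ∫ t in (0 : ℝ)..x, ψ t ^ 2) atTop (𝓝 L))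
    (hR : ∀ x, R ≤ x → 1 ≤ 2 * β * (β * W x - E)) {x : ℝ} (hx : R ≤ x) : ψ x * dψ x ≤ 0 := by
  by_contra! hpos
  have hmono : MonotoneOn (fun x => ψ x * dψ x) (Set.Ici R) :=
    monotoneOn_of_hasDerivAt_nonneg (convex_Ici R) (fun y _ => h.hasDerivAt_mul_deriv y)
      fun y hy => by have := hR y hy; positivity
  have hmono2 : MonotoneOn (fun x => ψ x ^ 2) (Set.Ici x) := by
    refine monotoneOn_of_hasDerivAt_nonneg (convex_Ici x) (fun y _ => (h.hasDerivAt y).pow 2) ?_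
    intro y hy
    have := hmono (Set.mem_Ici.2 hx) (Set.mem_Ici.2 (hx.trans hy)) hy
    simp only at this
    simp only [Nat.cast_ofNat, Nat.add_one_sub_one, pow_one]
    nlinarith
  have hψ : 0 < ψ x ^ 2 := by
    have : ψ x ≠ 0 := fun h0 => by simp [h0] at hpos
    positivity
  have hc : Continuous fun t => ψ t ^ 2 := h.continuous.pow 2
  have hge : ∀ᶠ y in atTop, ψ x ^ 2 ≤ ∫ t in (y - 1)..y, ψ t ^ 2 := by
    filter_upwards [eventually_ge_atTop (x + 1)] with y hy
    have : ∫ t in (y - 1)..y, ψ x ^ 2 ≤ ∫ t in (y - 1)..y, ψ t ^ 2 := by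
      refine intervalIntegral.integral_mono_on (by linarith) (by simp) (hc.intervalIntegrable _ _) ?_
      intro t ht
      exact hmono2 (Set.mem_Ici.2 le_rfl) (Set.mem_Ici.2 (by linarith [ht.1])) (by linarith [ht.1])
    simpa using this
  exact absurd (ge_of_tendsto (h.tendsto_integral_unit hI) hge) (not_le.2 hψ)

/-- Since `ψ²` is eventually decreasing, it is at most the mass of the preceding unit interval. -/
lemma tendsto_zero (h : IsSolution β E ψ dψ)
    (hI : Tendsto (fun x => ∫ t in (0 : ℝ)..x, ψ t ^ 2) atTop (𝓝 L))
    (hR : ∀ x, R ≤ x → 1 ≤ 2 * β * (β * W x - E)) : Tendsto ψ atTop (𝓝 0) := by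
  have hanti : AntitoneOn (fun x => ψ x ^ 2) (Set.Ici R) := by
    refine antitoneOn_of_hasDerivAt_nonpos (convex_Ici R) (fun y _ => (h.hasDerivAt y).pow 2) ?_
    intro y hy
    have := h.mul_deriv_nonpos hI hR hy
    simp only [Nat.cast_ofNat, Nat.add_one_sub_one, pow_one]
    nlinarith
  have hc : Continuous fun t => ψ t ^ 2 := h.continuous.pow 2
  have hsq : Tendsto (fun x => ψ x ^ 2) atTop (𝓝 0) := by
    refine tendsto_of_tendsto_of_tendsto_of_le_of_le' tendsto_const_nhds
      (h.tendsto_integral_unit hI) (Eventually.of_forall fun x => sq_nonneg _) ?_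
    filter_upwards [eventually_ge_atTop (R + 1)] with y hy
    have : ∫ t in (y - 1)..y, ψ y ^ 2 ≤ ∫ t in (y - 1)..y, ψ t ^ 2 := by
      refine intervalIntegral.integral_mono_on (by linarith) (by simp) (hc.intervalIntegrable _ _) ?_
      intro t ht
      exact hanti (Set.mem_Ici.2 (by linarith [ht.1])) (Set.mem_Ici.2 (by linarith)) ht.2
    simpa using this
  have := hsq.sqrt
  simp only [Real.sqrt_sq_eq_abs, Real.sqrt_zero] at this
  exact (tendsto_zero_iff_abs_tendsto_zero _).2 this

/-- Since `ψ'²` is eventually decreasing, `|ψ' y|` is at most the mean slope `|ψ y - ψ (y - 1)|`. -/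
lemma tendsto_deriv_zero (h : IsSolution β E ψ dψ)
    (hI : Tendsto (fun x => ∫ t in (0 : ℝ)..x, ψ t ^ 2) atTop (𝓝 L))
    (hR : ∀ x, R ≤ x → 1 ≤ 2 * β * (β * W x - E)) : Tendsto dψ atTop (𝓝 0) := by
  have hanti : AntitoneOn (fun x => dψ x ^ 2) (Set.Ici R) := by
    refine antitoneOn_of_hasDerivAt_nonpos (convex_Ici R) (fun y _ => (h.hasDerivAt_deriv y).pow 2) ?_
    intro y hy
    have h1 := h.mul_deriv_nonpos hI hR hy
    have h2 := hR y hy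
    simp only [Nat.cast_ofNat, Nat.add_one_sub_one, pow_one]
    nlinarith [mul_nonpos_of_nonneg_of_nonpos (zero_le_one.trans h2) h1]
  have h0 := h.tendsto_zero hI hR
  have hd := (h0.sub (h0.comp (tendsto_atTop_add_const_right atTop (-1 : ℝ) tendsto_id))).abs
  simp only [sub_self, abs_zero] at hd
  refine (tendsto_zero_iff_abs_tendsto_zero _).2
    (tendsto_of_tendsto_of_tendsto_of_le_of_le' tendsto_const_nhds hd
    (Eventually.of_forall fun x => abs_nonneg _) ?_)
  filter_upwards [eventually_ge_atTop (R + 1)] with y hy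
  obtain ⟨t, ht, hte⟩ := exists_hasDerivAt_eq_slope ψ dψ (by linarith : y - 1 < y)
    h.continuous.continuousOn fun x _ => h.hasDerivAt x
  have := hanti (Set.mem_Ici.2 (by linarith [ht.1])) (Set.mem_Ici.2 (by linarith)) ht.2.le
  simp only [Function.comp_apply, id, ← sub_eq_add_neg]
  have hte' : dψ t = ψ y - ψ (y - 1) := by rw [hte]; simp
  rw [← hte']
  exact sq_le_sq.1 this

end IsSolution

lemma exists_one_le_potential {β : ℝ} (hβ : 0 < β) (E : ℝ) :
    ∃ R, ∀ x, R ≤ x → 1 ≤ 2 * β * (β * W x - E) := by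
  have hW : Tendsto W atTop atTop := by
    refine tendsto_atTop_mono' _ ?_ tendsto_id
    filter_upwards [eventually_ge_atTop 2] with x hx
    simp only [W, id]
    nlinarith [sq_nonneg (x ^ 2 - 4)]
  have h := ((hW.const_mul_atTop hβ).atTop_add (tendsto_const_nhds (x := -E))).const_mul_atTop
    (by positivity : (0 : ℝ) < 2 * β)
  exact (eventually_atTop.1 (h.eventually_ge_atTop 1))

lemma tendsto_integral_sq {ψ : ℝ → ℝ} (hL : MemLp ψ 2 volume) :
    Tendsto (fun x => ∫ t in (0 : ℝ)..x, ψ t ^ 2) atTop (𝓝 (∫ t in Set.Ioi 0, ψ t ^ 2)) :=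
  intervalIntegral_tendsto_integral_Ioi 0 hL.integrable_sq.integrableOn tendsto_id

/-- The Wronskian of an `L²` solution and its reflection vanishes. -/
lemma IsSolution.wronskian_comp_neg {β E : ℝ} {ψ dψ : ℝ → ℝ} (h : IsSolution β E ψ dψ) (hβ : 0 < β)
    (hL : MemLp ψ 2 volume) (x : ℝ) : ψ x * -dψ (-x) - ψ (-x) * dψ x = 0 := by
  obtain ⟨R, hR⟩ := exists_one_le_potential hβ E
  have hL' : MemLp (fun x => ψ (-x)) 2 volume :=
    hL.comp_measurePreserving (Measure.measurePreserving_neg volume)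
  have h' := h.comp_neg
  have I := tendsto_integral_sq hL
  have I' := tendsto_integral_sq hL'
  have hlim := ((h.tendsto_zero I hR).mul (h'.tendsto_deriv_zero I' hR)).sub
    ((h'.tendsto_zero I' hR).mul (h.tendsto_deriv_zero I hR))
  have hconst : ∀ y, (fun x => ψ x * -dψ (-x) - ψ (-x) * dψ x) y = ψ x * -dψ (-x) - ψ (-x) * dψ x :=
    fun y => is_const_of_deriv_eq_zero
      (fun y => (h.hasDerivAt_wronskian h' y).differentiableAt)
      (fun y => by rw [(h.hasDerivAt_wronskian h' y).deriv]; simp) y x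
  have := tendsto_nhds_unique (tendsto_const_nhds.congr fun y => (hconst y).symm) hlim
  simpa using this

/-- An `L²` solution that is positive on the positive half-line is proportional to its reflection
there. -/
lemma IsSolution.exists_comp_neg_eq_mul {β E : ℝ} {ψ dψ : ℝ → ℝ} (h : IsSolution β E ψ dψ)
    (hβ : 0 < β) (hL : MemLp ψ 2 volume) (hpos : ∀ x, 0 < x → 0 < ψ x) :
    ∃ c, ∀ x, 0 < x → ψ (-x) = c * ψ x := by
  have hd : ∀ x ∈ Set.Ioi (0 : ℝ), HasDerivAt (fun x => ψ (-x) / ψ x) 0 x := by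
    intro x hx
    refine ((h.comp_neg.hasDerivAt x).div (h.hasDerivAt x) (hpos x hx).ne').congr_deriv ?_
    rw [div_eq_zero_iff]; left
    linarith [h.wronskian_comp_neg hβ hL x]
  refine ⟨ψ (-1) / ψ 1, fun x hx => ?_⟩
  rw [← div_eq_iff (hpos x hx).ne']
  exact (convex_Ioi (0 : ℝ)).is_const_of_fderivWithin_eq_zero (𝕜 := ℝ)
    (fun y hy => (hd y hy).differentiableAt.differentiableWithinAt)
    (fun y hy => by
      rw [fderivWithin_of_isOpen isOpen_Ioi hy, (hd y hy).hasFDerivAt.fderiv]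
      ext; simp) hx (Set.mem_Ioi.2 one_pos)

lemma integral_eq_Ioi_add_comp_neg {f : ℝ → ℝ} (hf : Integrable f) :
    ∫ x, f x = (∫ x in Set.Ioi 0, f (-x)) + ∫ x in Set.Ioi 0, f x := by
  rw [← intervalIntegral.integral_Iic_add_Ioi hf.integrableOn hf.integrableOn (b := 0)]
  congr 1
  simp

lemma integral_sq_eq_one {ψ : ℝ → ℝ} (hL : MemLp ψ 2 volume) (h1 : ‖(hL.toLp : L2)‖ = 1) :
    ∫ x, ψ x ^ 2 = 1 := by
  have h2 : inner ℝ (hL.toLp : L2) hL.toLp = 1 := by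
    rw [real_inner_self_eq_norm_sq, h1]; norm_num
  rw [L2.inner_def] at h2
  rw [← h2]
  refine integral_congr_ae ?_
  filter_upwards [hL.coeFn_toLp] with x hx
  rw [hx]; simp [sq]

/-- The restrictions to the half-line of the first two eigenfunctions. -/
structure IsHalfLinePair (β E₀ E₁ : ℝ) (ψ₀ dψ₀ ψ₁ dψ₁ : ℝ → ℝ) : Prop where
  one_le : 1 ≤ β
  sol₀ : IsSolution β E₀ ψ₀ dψ₀
  sol₁ : IsSolution β E₁ ψ₁ dψ₁
  pos₀ : ∀ x, 0 < ψ₀ x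
  pos₁ : ∀ x, 0 < x → 0 < ψ₁ x
  deriv_zero : dψ₀ 0 = 0
  zero : ψ₁ 0 = 0
  mass₀ : Tendsto (fun x => ∫ t in (0 : ℝ)..x, ψ₀ t ^ 2) atTop (𝓝 (1 / 2))
  mass₁ : Tendsto (fun x => ∫ t in (0 : ℝ)..x, ψ₁ t ^ 2) atTop (𝓝 (1 / 2))

lemma tendsto_integral_sq_half {ψ : ℝ → ℝ} (hL : MemLp ψ 2 volume) (h1 : ‖(hL.toLp : L2)‖ = 1)
    (hs : ∀ x, 0 < x → ψ (-x) ^ 2 = ψ x ^ 2) :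
    Tendsto (fun x => ∫ t in (0 : ℝ)..x, ψ t ^ 2) atTop (𝓝 (1 / 2)) := by
  have h2 := integral_sq_eq_one hL h1
  rw [integral_eq_Ioi_add_comp_neg hL.integrable_sq,
    setIntegral_congr_fun measurableSet_Ioi fun x hx => hs x hx] at h2
  convert tendsto_integral_sq hL using 2
  linarith

/-- Each eigenfunction is a constant multiple of its reflection. The multiple is `1` for `ψ₀`, by
its nonzero value at `0`; for `ψ₁` orthogonality reads `(c₁ + 1) ∫ ψ₀ ψ₁ = 0` over the positive
half-line, so it is `-1`. -/
theorem IsFirstTwoEigenpairs.exists_isHalfLinePair {β E₀ E₁ : ℝ} {ψ₀ ψ₁ : ℝ → ℝ} (hβ : 1 ≤ β)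
    (h : IsFirstTwoEigenpairs β E₀ E₁ ψ₀ ψ₁) :
    ∃ dψ₀ dψ₁, IsHalfLinePair β E₀ E₁ ψ₀ dψ₀ ψ₁ dψ₁ := by
  have hβ0 : 0 < β := by linarith
  obtain ⟨dψ₀, s₀⟩ := h.eigen₀.exists_isSolution hβ0 h.continuous₀ h.memLp₀
  obtain ⟨dψ₁, s₁⟩ := h.eigen₁.exists_isSolution hβ0 h.continuous₁ h.memLp₁
  have hd0 : dψ₀ 0 = 0 := by
    have h1 := s₀.wronskian_comp_neg hβ0 h.memLp₀ 0
    have h2 := h.pos₀ 0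
    simp only [neg_zero] at h1
    have h3 : ψ₀ 0 * dψ₀ 0 = 0 := by linarith
    exact (mul_eq_zero.1 h3).resolve_left h2.ne'
  -- passing to the limit `x → 0` in `ψ (-x) = c * ψ x`
  have hlim : ∀ {ψ : ℝ → ℝ} {c : ℝ}, Continuous ψ → (∀ x, 0 < x → ψ (-x) = c * ψ x) →
      ψ 0 = c * ψ 0 := by
    intro ψ c hψ hc
    have t1 : Tendsto (fun x => ψ (-x)) (𝓝[>] 0) (𝓝 (ψ 0)) := by
      have : Continuous fun x => ψ (-x) := by fun_prop
      simpa using (this.tendsto 0).mono_left nhdsWithin_le_nhds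
    have t2 : Tendsto (fun x => c * ψ x) (𝓝[>] 0) (𝓝 (c * ψ 0)) :=
      ((continuous_const.mul hψ).tendsto 0).mono_left nhdsWithin_le_nhds
    refine tendsto_nhds_unique (t1.congr' ?_) t2
    filter_upwards [self_mem_nhdsWithin] with x hx using hc x hx
  obtain ⟨c₀, hc₀⟩ := s₀.exists_comp_neg_eq_mul hβ0 h.memLp₀ fun x _ => h.pos₀ x
  have hc₀1 : c₀ = 1 := by
    have := hlim h.continuous₀ hc₀
    have h0 := h.pos₀ 0
    nlinarith
  obtain ⟨c₁, hc₁⟩ := s₁.exists_comp_neg_eq_mul hβ0 h.memLp₁ h.pos₁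
  have hint : Integrable fun x => ψ₀ x * ψ₁ x := h.memLp₀.integrable_mul h.memLp₁
  have horth : ∫ x, ψ₀ x * ψ₁ x = 0 := by
    rw [← h.orthogonal, L2.inner_def]
    refine integral_congr_ae ?_
    filter_upwards [h.memLp₀.coeFn_toLp, h.memLp₁.coeFn_toLp] with x h1 h2
    rw [h1, h2]; simp [mul_comm]
  have hpos : 0 < ∫ x in Set.Ioi 0, ψ₀ x * ψ₁ x := by
    rw [setIntegral_pos_iff_support_of_nonneg_ae]
    · have : Set.Ioi (0 : ℝ) ⊆ Function.support (fun x => ψ₀ x * ψ₁ x) ∩ Set.Ioi 0 := fun x hx =>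
        ⟨(mul_pos (h.pos₀ x) (h.pos₁ x hx)).ne', hx⟩
      exact lt_of_lt_of_le (by simp) (measure_mono this)
    · filter_upwards [ae_restrict_mem measurableSet_Ioi] with x hx
      exact (mul_pos (h.pos₀ x) (h.pos₁ x hx)).le
    · exact hint.integrableOn
  have hc₁1 : c₁ = -1 := by
    rw [integral_eq_Ioi_add_comp_neg hint,
      setIntegral_congr_fun (g := fun x => c₁ * (ψ₀ x * ψ₁ x)) measurableSet_Ioi fun x hx => by
        simp only [hc₀ x hx, hc₁ x hx, hc₀1]; ring, integral_const_mul] at horth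
    have : (c₁ + 1) * ∫ x in Set.Ioi 0, ψ₀ x * ψ₁ x = 0 := by linarith
    linarith [(mul_eq_zero.1 this).resolve_right hpos.ne']
  refine ⟨dψ₀, dψ₁, hβ, s₀, s₁, h.pos₀, h.pos₁, hd0, ?_, ?_, ?_⟩
  · have := hlim h.continuous₁ hc₁
    rw [hc₁1] at this; linarith
  · exact tendsto_integral_sq_half h.memLp₀ h.norm₀ fun x hx => by rw [hc₀ x hx, hc₀1, one_mul]
  · exact tendsto_integral_sq_half h.memLp₁ h.norm₁ fun x hx => by rw [hc₁ x hx, hc₁1]; ring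

end DoubleWell

/-! ### Tail masses and bounds uniform in `β`. -/

namespace DoubleWell

/-- The tail mass `1/2 - ∫₀^y ψ²` of a function with mass `1/2` on the half-line. -/
noncomputable def tail (ψ : ℝ → ℝ) (y : ℝ) : ℝ := 1 / 2 - ∫ t in (0 : ℝ)..y, ψ t ^ 2

section Tail

variable {ψ : ℝ → ℝ}

lemma hasDerivAt_tail (hc : Continuous ψ) (y : ℝ) : HasDerivAt (tail ψ) (-ψ y ^ 2) y :=
  (hasDerivAt_integral_of_continuous (f := fun t => ψ t ^ 2) (by fun_prop) 0 y).const_sub (1 / 2)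

lemma continuous_tail (hc : Continuous ψ) : Continuous (tail ψ) :=
  continuous_iff_continuousAt.2 fun y => (hasDerivAt_tail hc y).continuousAt

lemma antitone_tail (hc : Continuous ψ) : Antitone (tail ψ) :=
  antitone_of_hasDerivAt_nonpos (fun y => hasDerivAt_tail hc y) fun _ =>
    neg_nonpos.2 (sq_nonneg _)

lemma tendsto_tail (hI : Tendsto (fun x => ∫ t in (0 : ℝ)..x, ψ t ^ 2) atTop (𝓝 (1 / 2))) :
    Tendsto (tail ψ) atTop (𝓝 0) := by
  have := hI.const_sub (1 / 2)
  rwa [sub_self] at this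

lemma tail_nonneg (hc : Continuous ψ)
    (hI : Tendsto (fun x => ∫ t in (0 : ℝ)..x, ψ t ^ 2) atTop (𝓝 (1 / 2))) (y : ℝ) :
    0 ≤ tail ψ y :=
  (antitone_tail hc).le_of_tendsto (tendsto_tail hI) y

lemma tail_zero (ψ : ℝ → ℝ) : tail ψ 0 = 1 / 2 := by simp [tail]

lemma integral_sq_eq_tail_sub_tail (hc : Continuous ψ) (a b : ℝ) :
    ∫ t in a..b, ψ t ^ 2 = tail ψ a - tail ψ b := by
  have hc2 : Continuous fun t => ψ t ^ 2 := by fun_prop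
  rw [tail, tail, ← intervalIntegral.integral_interval_sub_left (hc2.intervalIntegrable 0 b)
    (hc2.intervalIntegrable 0 a)]
  ring

end Tail

/-- A forbidden region independent of `β`; the energy bound `6` is the one provided by `energy₁_le`.
-/
lemma one_le_potential_of_three_le {β E x : ℝ} (hβ : 1 ≤ β) (hE : E ≤ 6) (hx : 3 ≤ x) :
    1 ≤ 2 * β * (β * W x - E) := by
  have hW : 32 ≤ W x := by
    have : 9 ≤ x ^ 2 := by nlinarith
    unfold W; nlinarith
  have : 1 ≤ β * W x - E := by nlinarith
  nlinarith

namespace IsSolution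

variable {β E : ℝ} {ψ dψ : ℝ → ℝ}

lemma deriv_nonpos_of_three_le (h : IsSolution β E ψ dψ) (hβ : 1 ≤ β) (hE : E ≤ 6)
    (hpos : ∀ x, 0 < x → 0 < ψ x)
    (hI : Tendsto (fun x => ∫ t in (0 : ℝ)..x, ψ t ^ 2) atTop (𝓝 (1 / 2))) {x : ℝ} (hx : 3 ≤ x) :
    dψ x ≤ 0 := by
  have := h.mul_deriv_nonpos hI (fun x hx => one_le_potential_of_three_le hβ hE hx) hx
  exact nonpos_of_mul_nonpos_right this (hpos x (by linarith))

/-- Exponential decay in differential form. -/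
lemma deriv_le_neg_of_three_le (h : IsSolution β E ψ dψ) (hβ : 1 ≤ β) (hE : E ≤ 6)
    (hpos : ∀ x, 0 < x → 0 < ψ x)
    (hI : Tendsto (fun x => ∫ t in (0 : ℝ)..x, ψ t ^ 2) atTop (𝓝 (1 / 2))) {x : ℝ} (hx : 3 ≤ x) :
    dψ x ≤ -ψ x := by
  have hR : ∀ x, 3 ≤ x → 1 ≤ 2 * β * (β * W x - E) := fun x hx =>
    one_le_potential_of_three_le hβ hE hx
  -- This quantity decreases to `0`, hence is nonnegative, and `ψ' ≤ 0` selects the sign of the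
  -- root.
  have hanti : AntitoneOn (fun x => dψ x ^ 2 - ψ x ^ 2) (Set.Ici 3) := by
    refine antitoneOn_of_hasDerivAt_nonpos (convex_Ici 3)
      (fun y _ => ((h.hasDerivAt_deriv y).pow 2).sub ((h.hasDerivAt y).pow 2)) ?_
    intro y hy
    have h1 := h.deriv_nonpos_of_three_le hβ hE hpos hI hy
    have h2 := hR y hy
    have h3 := hpos y (by linarith [Set.mem_Ici.1 hy])
    simp only [Nat.cast_ofNat, Nat.add_one_sub_one, pow_one]
    nlinarith [mul_nonneg (mul_nonneg (sub_nonneg.2 h2) h3.le) (neg_nonneg.2 h1)]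
  have hlim : Tendsto (fun x => dψ x ^ 2 - ψ x ^ 2) atTop (𝓝 0) := by
    simpa using ((h.tendsto_deriv_zero hI hR).pow 2).sub ((h.tendsto_zero hI hR).pow 2)
  have h0 : 0 ≤ dψ x ^ 2 - ψ x ^ 2 := by
    refine le_of_tendsto hlim ?_
    filter_upwards [eventually_ge_atTop x] with y hy
    exact hanti (Set.mem_Ici.2 hx) (Set.mem_Ici.2 (hx.trans hy)) hy
  have h1 := h.deriv_nonpos_of_three_le hβ hE hpos hI hx
  have h3 := hpos x (by linarith)
  nlinarith

/-- Both sides vanish at infinity, and `(ψ² / 2)' = ψ ψ' ≤ -ψ²`, which is the derivative of the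
tail. -/
lemma tail_le_of_three_le (h : IsSolution β E ψ dψ) (hβ : 1 ≤ β) (hE : E ≤ 6)
    (hpos : ∀ x, 0 < x → 0 < ψ x)
    (hI : Tendsto (fun x => ∫ t in (0 : ℝ)..x, ψ t ^ 2) atTop (𝓝 (1 / 2))) {x : ℝ} (hx : 3 ≤ x) :
    tail ψ x ≤ ψ x ^ 2 / 2 := by
  have hmono : MonotoneOn (fun x => tail ψ x - ψ x ^ 2 / 2) (Set.Ici 3) := by
    refine monotoneOn_of_hasDerivAt_nonneg (convex_Ici 3)
      (fun y _ => (hasDerivAt_tail h.continuous y).sub (((h.hasDerivAt y).pow 2).div_const 2)) ?_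
    intro y hy
    have h1 := h.deriv_le_neg_of_three_le hβ hE hpos hI hy
    have h3 := hpos y (by linarith [Set.mem_Ici.1 hy])
    simp only [Nat.cast_ofNat, Nat.add_one_sub_one, pow_one]
    nlinarith
  have hlim : Tendsto (fun x => tail ψ x - ψ x ^ 2 / 2) atTop (𝓝 0) := by
    simpa using (tendsto_tail hI).sub (((h.tendsto_zero hI
      fun x hx => one_le_potential_of_three_le hβ hE hx).pow 2).div_const 2)
  have h0 : tail ψ x - ψ x ^ 2 / 2 ≤ 0 := by
    refine ge_of_tendsto hlim ?_
    filter_upwards [eventually_ge_atTop x] with y hy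
    exact hmono (Set.mem_Ici.2 hx) (Set.mem_Ici.2 (hx.trans hy)) hy
  linarith

/-- The interval `[0, 3]` contributes at most `3 * (1/2)`. Beyond `3` the tail is at most `ψ²`,
whose remaining mass is at most `1/2`. -/
lemma integral_tail_le (h : IsSolution β E ψ dψ) (hβ : 1 ≤ β) (hE : E ≤ 6)
    (hpos : ∀ x, 0 < x → 0 < ψ x)
    (hI : Tendsto (fun x => ∫ t in (0 : ℝ)..x, ψ t ^ 2) atTop (𝓝 (1 / 2))) {x : ℝ} (hx : 0 ≤ x) :
    ∫ y in (0 : ℝ)..x, tail ψ y ≤ 2 := by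
  have hct := continuous_tail h.continuous
  have hc2 : Continuous fun t => ψ t ^ 2 := h.continuous.pow 2
  have h3 : ∫ y in (0 : ℝ)..3, tail ψ y ≤ 3 / 2 := by
    have : ∫ y in (0 : ℝ)..3, tail ψ y ≤ ∫ y in (0 : ℝ)..3, (1 / 2 : ℝ) := by
      refine intervalIntegral.integral_mono_on (by norm_num) (hct.intervalIntegrable _ _) (by simp) ?_
      intro y hy
      exact (antitone_tail h.continuous hy.1).trans_eq (tail_zero ψ)
    refine this.trans_eq ?_
    simp; norm_num
  have hmax : ∫ y in (3 : ℝ)..(max x 3), tail ψ y ≤ 1 / 2 := by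
    have : ∫ y in (3 : ℝ)..(max x 3), tail ψ y ≤ ∫ y in (3 : ℝ)..(max x 3), ψ y ^ 2 := by
      refine intervalIntegral.integral_mono_on (le_max_right _ _) (hct.intervalIntegrable _ _)
        (hc2.intervalIntegrable _ _) ?_
      intro y hy
      have := h.tail_le_of_three_le hβ hE hpos hI hy.1
      nlinarith [sq_nonneg (ψ y)]
    rw [integral_sq_eq_tail_sub_tail h.continuous] at this
    have h0 := tail_nonneg h.continuous hI (max x 3)
    have h1 := antitone_tail h.continuous (show (0 : ℝ) ≤ 3 by norm_num)
    rw [tail_zero] at h1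
    linarith
  have hle : ∫ y in (0 : ℝ)..x, tail ψ y ≤ ∫ y in (0 : ℝ)..(max x 3), tail ψ y :=
    intervalIntegral.integral_mono_interval le_rfl hx (le_max_left _ _)
      (Eventually.of_forall fun y => tail_nonneg h.continuous hI y) (hct.intervalIntegrable _ _)
  have hadd := intervalIntegral.integral_add_adjacent_intervals
    (hct.intervalIntegrable (μ := volume) 0 3) (hct.intervalIntegrable 3 (max x 3))
  linarith

end IsSolution

namespace IsHalfLinePair

variable {β E₀ E₁ : ℝ} {ψ₀ dψ₀ ψ₁ dψ₁ : ℝ → ℝ}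

/-- Sturm comparison with `cos (π √β (x - 1))` on `|x - 1| ≤ 1 / (2 √β)`. -/
lemma energy₁_le (h : IsHalfLinePair β E₀ E₁ ψ₀ dψ₀ ψ₁ dψ₁) : E₁ ≤ 6 := by
  by_contra! hE
  have hβ := h.one_le
  set s := Real.sqrt β with hs
  have hs1 : 1 ≤ s := Real.one_le_sqrt.2 hβ
  have hs2 : s ^ 2 = β := Real.sq_sqrt (by linarith)
  set k := Real.pi * s with hk
  have hk0 : 0 < k := by have := Real.pi_pos; positivity
  set d := 1 / (2 * s) with hd
  have hd0 : 0 < d := by positivity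
  have hd1 : d ≤ 1 / 2 := by rw [hd]; gcongr; linarith
  have hsd : s * d = 1 / 2 := by rw [hd]; field_simp
  have hkd : k * d = Real.pi / 2 := by rw [hk, mul_assoc, hsd]; ring
  have hu : ∀ x, HasDerivAt (fun x => Real.cos (k * (x - 1))) (-(k * Real.sin (k * (x - 1)))) x := by
    intro x
    refine ((((hasDerivAt_id x).sub_const 1).const_mul k).cos).congr_deriv ?_
    simp [mul_comm]
  have hdu : ∀ x, HasDerivAt (fun x => -(k * Real.sin (k * (x - 1))))
      (-(k ^ 2 * Real.cos (k * (x - 1)))) x := by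
    intro x
    refine ((((((hasDerivAt_id x).sub_const 1).const_mul k).sin).const_mul k).fun_neg).congr_deriv ?_
    simp; ring
  have hmono : MonotoneOn (fun x => ψ₁ x * -(k * Real.sin (k * (x - 1)))
      - Real.cos (k * (x - 1)) * dψ₁ x) (Set.Icc (1 - d) (1 + d)) := by
    refine monotoneOn_of_hasDerivAt_nonneg (convex_Icc _ _)
      (fun x _ => ((h.sol₁.hasDerivAt x).mul (hdu x)).sub ((hu x).mul (h.sol₁.hasDerivAt_deriv x))) ?_
    intro x hx
    have hxd : |x - 1| ≤ d := abs_le.2 ⟨by linarith [hx.1], by linarith [hx.2]⟩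
    have hcos : 0 ≤ Real.cos (k * (x - 1)) := by
      refine Real.cos_nonneg_of_mem_Icc ⟨?_, ?_⟩
      · nlinarith [hx.1]
      · nlinarith [hx.2]
    have hψ := (h.pos₁ x (by linarith [hx.1])).le
    have hx1 : (x - 1) ^ 2 ≤ d ^ 2 := sq_le_sq.2 (by rwa [abs_of_pos hd0])
    have hW : 2 * β * W x ≤ 25 / 16 := by
      have e : 2 * β * W x = (s * (x - 1)) ^ 2 * (x + 1) ^ 2 := by rw [← hs2, W]; ring
      have h1 : (s * (x - 1)) ^ 2 ≤ 1 / 4 := by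
        have : s ^ 2 * (x - 1) ^ 2 ≤ s ^ 2 * d ^ 2 := by gcongr
        nlinarith
      have h2 : (x + 1) ^ 2 ≤ 25 / 4 := by nlinarith [hx.1, hx.2]
      rw [e]
      calc _ ≤ (1 / 4 : ℝ) * (25 / 4) := by gcongr
        _ = _ := by norm_num
    have hpi : Real.pi ^ 2 ≤ 10 := by nlinarith [Real.pi_lt_d4, Real.pi_pos]
    -- The bound `6` suffices because `12 > 25/16 + 10`.
    have hmain : 0 ≤ β * (2 * E₁ - 2 * β * W x - Real.pi ^ 2) :=
      mul_nonneg (by linarith) (by linarith)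
    have hk2 : k ^ 2 = Real.pi ^ 2 * β := by rw [hk, mul_pow, hs2]
    have := mul_nonneg (mul_nonneg hψ hcos) hmain
    rw [hk2]
    linarith
  -- The cosine vanishes at both ends, where the Wronskian equals `k ψ₁ (1 - d) > 0` and `-k ψ₁ (1 +
  -- d) < 0`, against monotonicity.
  have := hmono (Set.left_mem_Icc.2 (by linarith)) (Set.right_mem_Icc.2 (by linarith))
    (by linarith : 1 - d ≤ 1 + d)
  have e1 : k * (1 - d - 1) = -(Real.pi / 2) := by linarith
  have e2 : k * (1 + d - 1) = Real.pi / 2 := by linarith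
  simp only [e1, e2, Real.sin_neg, Real.cos_neg, Real.sin_pi_div_two, Real.cos_pi_div_two] at this
  have p1 := mul_pos (h.pos₁ (1 - d) (by linarith)) hk0
  have p2 := mul_pos (h.pos₁ (1 + d) (by linarith)) hk0
  linarith

end IsHalfLinePair
end DoubleWell

/-! ### The quotient `ψ₁ / ψ₀` and the Wronskian. -/

namespace DoubleWell

/-- The quotient `ψ₁ / ψ₀`. -/
noncomputable def ratio (ψ₀ ψ₁ : ℝ → ℝ) (x : ℝ) : ℝ := ψ₁ x / ψ₀ x

/-- The Wronskian `ψ₀ ψ₁' - ψ₁ ψ₀'`. -/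
def wronskian (ψ₀ dψ₀ ψ₁ dψ₁ : ℝ → ℝ) (x : ℝ) : ℝ := ψ₀ x * dψ₁ x - ψ₁ x * dψ₀ x

namespace IsHalfLinePair

variable {β E₀ E₁ : ℝ} {ψ₀ dψ₀ ψ₁ dψ₁ : ℝ → ℝ}

lemma ratio_mul (h : IsHalfLinePair β E₀ E₁ ψ₀ dψ₀ ψ₁ dψ₁) (x : ℝ) :
    ratio ψ₀ ψ₁ x * ψ₀ x = ψ₁ x := div_mul_cancel₀ _ (h.pos₀ x).ne'

lemma hasDerivAt_ratio (h : IsHalfLinePair β E₀ E₁ ψ₀ dψ₀ ψ₁ dψ₁) (x : ℝ) :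
    HasDerivAt (ratio ψ₀ ψ₁) (wronskian ψ₀ dψ₀ ψ₁ dψ₁ x / ψ₀ x ^ 2) x := by
  refine ((h.sol₁.hasDerivAt x).div (h.sol₀.hasDerivAt x) (h.pos₀ x).ne').congr_deriv ?_
  rw [wronskian]; ring

lemma hasDerivAt_wronskian (h : IsHalfLinePair β E₀ E₁ ψ₀ dψ₀ ψ₁ dψ₁) (x : ℝ) :
    HasDerivAt (wronskian ψ₀ dψ₀ ψ₁ dψ₁) (-(2 * β * (E₁ - E₀)) * (ψ₀ x * ψ₁ x)) x :=
  h.sol₀.hasDerivAt_wronskian h.sol₁ x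

lemma continuous_ratio (h : IsHalfLinePair β E₀ E₁ ψ₀ dψ₀ ψ₁ dψ₁) : Continuous (ratio ψ₀ ψ₁) :=
  continuous_iff_continuousAt.2 fun x => (h.hasDerivAt_ratio x).continuousAt

lemma continuous_wronskian (h : IsHalfLinePair β E₀ E₁ ψ₀ dψ₀ ψ₁ dψ₁) :
    Continuous (wronskian ψ₀ dψ₀ ψ₁ dψ₁) :=
  continuous_iff_continuousAt.2 fun x => (h.hasDerivAt_wronskian x).continuousAt

lemma tendsto_wronskian (h : IsHalfLinePair β E₀ E₁ ψ₀ dψ₀ ψ₁ dψ₁) :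
    Tendsto (wronskian ψ₀ dψ₀ ψ₁ dψ₁) atTop (𝓝 0) := by
  have hβ : 0 < β := by linarith [h.one_le]
  obtain ⟨R₀, hR₀⟩ := exists_one_le_potential hβ E₀
  obtain ⟨R₁, hR₁⟩ := exists_one_le_potential hβ E₁
  have := ((h.sol₀.tendsto_zero h.mass₀ hR₀).mul (h.sol₁.tendsto_deriv_zero h.mass₁ hR₁)).sub
    ((h.sol₁.tendsto_zero h.mass₁ hR₁).mul (h.sol₀.tendsto_deriv_zero h.mass₀ hR₀))
  rwa [mul_zero, sub_zero] at this

lemma nonneg₁ (h : IsHalfLinePair β E₀ E₁ ψ₀ dψ₀ ψ₁ dψ₁) {x : ℝ} (hx : 0 ≤ x) : 0 ≤ ψ₁ x := by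
  rcases hx.eq_or_lt with rfl | hx
  · exact h.zero.ge
  · exact (h.pos₁ x hx).le

/-- Otherwise the Wronskian increases to its limit `0`, so it is nonpositive and the quotient
decreases from `0`, contradicting its positivity at `1`. -/
lemma gap_pos (h : IsHalfLinePair β E₀ E₁ ψ₀ dψ₀ ψ₁ dψ₁) : 0 < E₁ - E₀ := by
  by_contra! hle
  have hβ := h.one_le
  have hmono : MonotoneOn (wronskian ψ₀ dψ₀ ψ₁ dψ₁) (Set.Ici 0) := by
    refine monotoneOn_of_hasDerivAt_nonneg (convex_Ici 0) (fun x _ => h.hasDerivAt_wronskian x) ?_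
    intro x hx
    have h1 := mul_nonneg (h.pos₀ x).le (h.nonneg₁ hx)
    have h2 : 0 ≤ -(2 * β * (E₁ - E₀)) := by nlinarith
    exact mul_nonneg h2 h1
  have hw : ∀ x, 0 ≤ x → wronskian ψ₀ dψ₀ ψ₁ dψ₁ x ≤ 0 := by
    intro x hx
    refine ge_of_tendsto h.tendsto_wronskian ?_
    filter_upwards [eventually_ge_atTop x] with y hy
    exact hmono (Set.mem_Ici.2 hx) (Set.mem_Ici.2 (hx.trans hy)) hy
  have hanti : AntitoneOn (ratio ψ₀ ψ₁) (Set.Ici 0) :=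
    antitoneOn_of_hasDerivAt_nonpos (convex_Ici 0) (fun x _ => h.hasDerivAt_ratio x)
      fun x hx => div_nonpos_of_nonpos_of_nonneg (hw x hx) (sq_nonneg _)
  have h1 := hanti (Set.mem_Ici.2 le_rfl) (Set.mem_Ici.2 zero_le_one) zero_le_one
  have h2 : ratio ψ₀ ψ₁ 0 = 0 := by simp [ratio, h.zero]
  have h3 : 0 < ratio ψ₀ ψ₁ 1 := div_pos (h.pos₁ 1 one_pos) (h.pos₀ 1)
  linarith

lemma energy₀_le (h : IsHalfLinePair β E₀ E₁ ψ₀ dψ₀ ψ₁ dψ₁) : E₀ ≤ 6 := by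
  linarith [h.gap_pos, h.energy₁_le]

lemma mul_gap_pos (h : IsHalfLinePair β E₀ E₁ ψ₀ dψ₀ ψ₁ dψ₁) : 0 < β * (E₁ - E₀) :=
  mul_pos (by linarith [h.one_le]) h.gap_pos

lemma antitoneOn_wronskian (h : IsHalfLinePair β E₀ E₁ ψ₀ dψ₀ ψ₁ dψ₁) :
    AntitoneOn (wronskian ψ₀ dψ₀ ψ₁ dψ₁) (Set.Ici 0) := by
  refine antitoneOn_of_hasDerivAt_nonpos (convex_Ici 0) (fun x _ => h.hasDerivAt_wronskian x) ?_
  intro x hx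
  have h1 := mul_nonneg (h.pos₀ x).le (h.nonneg₁ hx)
  have h2 := h.mul_gap_pos
  nlinarith

lemma wronskian_nonneg (h : IsHalfLinePair β E₀ E₁ ψ₀ dψ₀ ψ₁ dψ₁) {x : ℝ} (hx : 0 ≤ x) :
    0 ≤ wronskian ψ₀ dψ₀ ψ₁ dψ₁ x := by
  refine le_of_tendsto h.tendsto_wronskian ?_
  filter_upwards [eventually_ge_atTop x] with y hy
  exact h.antitoneOn_wronskian (Set.mem_Ici.2 hx) (Set.mem_Ici.2 (hx.trans hy)) hy

lemma monotoneOn_ratio (h : IsHalfLinePair β E₀ E₁ ψ₀ dψ₀ ψ₁ dψ₁) :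
    MonotoneOn (ratio ψ₀ ψ₁) (Set.Ici 0) :=
  monotoneOn_of_hasDerivAt_nonneg (convex_Ici 0) (fun x _ => h.hasDerivAt_ratio x)
    fun _ hx => div_nonneg (h.wronskian_nonneg hx) (sq_nonneg _)

lemma ratio_nonneg (h : IsHalfLinePair β E₀ E₁ ψ₀ dψ₀ ψ₁ dψ₁) {x : ℝ} (hx : 0 ≤ x) :
    0 ≤ ratio ψ₀ ψ₁ x := div_nonneg (h.nonneg₁ hx) (h.pos₀ x).le

/-- Integrate `w' = -2 ε ψ₀ ψ₁` from infinity and use `2 ψ₀ ψ₁ ≤ ψ₀² + ψ₁²`. -/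
lemma wronskian_le_tail (h : IsHalfLinePair β E₀ E₁ ψ₀ dψ₀ ψ₁ dψ₁) (x : ℝ) :
    wronskian ψ₀ dψ₀ ψ₁ dψ₁ x ≤ β * (E₁ - E₀) * (tail ψ₀ x + tail ψ₁ x) := by
  have hanti : Antitone fun x => β * (E₁ - E₀) * (tail ψ₀ x + tail ψ₁ x)
      - wronskian ψ₀ dψ₀ ψ₁ dψ₁ x := by
    refine antitone_of_hasDerivAt_nonpos (fun y => (((hasDerivAt_tail h.sol₀.continuous y).add
      (hasDerivAt_tail h.sol₁.continuous y)).const_mul (β * (E₁ - E₀))).sub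
      (h.hasDerivAt_wronskian y)) ?_
    intro y
    have := mul_nonneg h.mul_gap_pos.le (sq_nonneg (ψ₀ y - ψ₁ y))
    simp only [Pi.zero_apply]
    linarith
  have hlim : Tendsto (fun x => β * (E₁ - E₀) * (tail ψ₀ x + tail ψ₁ x)
      - wronskian ψ₀ dψ₀ ψ₁ dψ₁ x) atTop (𝓝 0) := by
    simpa using (((tendsto_tail h.mass₀).add (tendsto_tail h.mass₁)).const_mul
      (β * (E₁ - E₀))).sub h.tendsto_wronskian
  linarith [hanti.le_of_tendsto hlim x]

/-- As the quotient `r` is increasing, `r x * ψ₀ y ≤ ψ₁ y` for `y ≥ x`, so the product `ψ₀ ψ₁` under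
the integral becomes `ψ₁²`. -/
lemma ratio_mul_wronskian_le_tail (h : IsHalfLinePair β E₀ E₁ ψ₀ dψ₀ ψ₁ dψ₁) {x : ℝ} (hx : 0 ≤ x) :
    ratio ψ₀ ψ₁ x * wronskian ψ₀ dψ₀ ψ₁ dψ₁ x ≤ 2 * (β * (E₁ - E₀)) * tail ψ₁ x := by
  have hanti : AntitoneOn (fun y => 2 * (β * (E₁ - E₀)) * tail ψ₁ y
      - ratio ψ₀ ψ₁ x * wronskian ψ₀ dψ₀ ψ₁ dψ₁ y) (Set.Ici x) := by
    refine antitoneOn_of_hasDerivAt_nonpos (convex_Ici x)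
      (fun y _ => ((hasDerivAt_tail h.sol₁.continuous y).const_mul (2 * (β * (E₁ - E₀)))).sub
      ((h.hasDerivAt_wronskian y).const_mul (ratio ψ₀ ψ₁ x))) ?_
    intro y hy
    have hy0 : 0 ≤ y := hx.trans hy
    have h1 : ratio ψ₀ ψ₁ x * ψ₀ y ≤ ψ₁ y := by
      rw [← h.ratio_mul y]
      exact mul_le_mul_of_nonneg_right (h.monotoneOn_ratio hx hy0 hy) (h.pos₀ y).le
    have h2 := mul_le_mul_of_nonneg_right h1 (h.nonneg₁ hy0)
    have h3 := mul_le_mul_of_nonneg_left h2 h.mul_gap_pos.le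
    nlinarith
  have hlim : Tendsto (fun y => 2 * (β * (E₁ - E₀)) * tail ψ₁ y
      - ratio ψ₀ ψ₁ x * wronskian ψ₀ dψ₀ ψ₁ dψ₁ y) atTop (𝓝 0) := by
    simpa using ((tendsto_tail h.mass₁).const_mul (2 * (β * (E₁ - E₀)))).sub
      (h.tendsto_wronskian.const_mul (ratio ψ₀ ψ₁ x))
  have : 0 ≤ 2 * (β * (E₁ - E₀)) * tail ψ₁ x - ratio ψ₀ ψ₁ x * wronskian ψ₀ dψ₀ ψ₁ dψ₁ x := by
    refine le_of_tendsto hlim ?_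
    filter_upwards [eventually_ge_atTop x] with y hy
    exact hanti (Set.mem_Ici.2 le_rfl) hy hy
  linarith

lemma integral_le_of_le_tail (h : IsHalfLinePair β E₀ E₁ ψ₀ dψ₀ ψ₁ dψ₁) {g : ℝ → ℝ} {p q : ℝ}
    (hp : 0 ≤ p) (hq : 0 ≤ q) (hg : Continuous g)
    (hle : ∀ x, 0 ≤ x → g x ≤ p * tail ψ₀ x + q * tail ψ₁ x) {a b : ℝ} (ha : 0 ≤ a) (hab : a ≤ b) :
    ∫ x in a..b, g x ≤ 2 * (p + q) := by
  have c0 := continuous_tail h.sol₀.continuous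
  have c1 := continuous_tail h.sol₁.continuous
  have hb := ha.trans hab
  have hc : Continuous fun x => p * tail ψ₀ x + q * tail ψ₁ x := by fun_prop
  calc ∫ x in a..b, g x ≤ ∫ x in a..b, (p * tail ψ₀ x + q * tail ψ₁ x) :=
        intervalIntegral.integral_mono_on hab (hg.intervalIntegrable _ _) (hc.intervalIntegrable _ _)
          fun x hx => hle x (ha.trans hx.1)
    _ ≤ ∫ x in (0 : ℝ)..b, (p * tail ψ₀ x + q * tail ψ₁ x) := by
        refine intervalIntegral.integral_mono_interval ha hab le_rfl
          (Eventually.of_forall fun x => ?_) (hc.intervalIntegrable _ _)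
        have h0 := tail_nonneg h.sol₀.continuous h.mass₀ x
        have h1 := tail_nonneg h.sol₁.continuous h.mass₁ x
        simp only [Pi.zero_apply]
        positivity
    _ = p * (∫ x in (0 : ℝ)..b, tail ψ₀ x) + q * ∫ x in (0 : ℝ)..b, tail ψ₁ x := by
        rw [intervalIntegral.integral_add ((c0.const_mul p).intervalIntegrable _ _)
          ((c1.const_mul q).intervalIntegrable _ _), intervalIntegral.integral_const_mul,
          intervalIntegral.integral_const_mul]
    _ ≤ p * 2 + q * 2 := by
        gcongr
        · exact h.sol₀.integral_tail_le h.one_le h.energy₀_le (fun x _ => h.pos₀ x) h.mass₀ hb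
        · exact h.sol₁.integral_tail_le h.one_le h.energy₁_le h.pos₁ h.mass₁ hb
    _ = 2 * (p + q) := by ring

lemma integral_wronskian_le (h : IsHalfLinePair β E₀ E₁ ψ₀ dψ₀ ψ₁ dψ₁) {a b : ℝ} (ha : 0 ≤ a)
    (hab : a ≤ b) : ∫ x in a..b, wronskian ψ₀ dψ₀ ψ₁ dψ₁ x ≤ 4 * (β * (E₁ - E₀)) := by
  have := h.integral_le_of_le_tail h.mul_gap_pos.le h.mul_gap_pos.le h.continuous_wronskian
    (fun x _ => by linarith [h.wronskian_le_tail x]) ha hab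
  linarith

lemma integral_ratio_mul_wronskian_le (h : IsHalfLinePair β E₀ E₁ ψ₀ dψ₀ ψ₁ dψ₁) {a b : ℝ}
    (ha : 0 ≤ a) (hab : a ≤ b) :
    ∫ x in a..b, 2 * ratio ψ₀ ψ₁ x * wronskian ψ₀ dψ₀ ψ₁ dψ₁ x ≤ 8 * (β * (E₁ - E₀)) := by
  have c0 := h.continuous_wronskian
  have c1 := h.continuous_ratio
  have := h.integral_le_of_le_tail (p := 0) (q := 4 * (β * (E₁ - E₀))) le_rfl
    (by linarith [h.mul_gap_pos])
    (g := fun x => 2 * ratio ψ₀ ψ₁ x * wronskian ψ₀ dψ₀ ψ₁ dψ₁ x) (by fun_prop)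
    (fun x hx => by linarith [h.ratio_mul_wronskian_le_tail hx]) ha hab
  linarith

end IsHalfLinePair

/-! ### Unimodality of the ground state on the half-line. -/

/-- A function with derivative `dψ` is unimodal on the half-line with its maximum at `m ≤ 3`. -/
structure IsPeak (dψ : ℝ → ℝ) (m : ℝ) : Prop where
  nonneg : 0 ≤ m
  le_three : m ≤ 3
  deriv_nonneg : ∀ x, 0 ≤ x → x ≤ m → 0 ≤ dψ x
  deriv_nonpos : ∀ x, m ≤ x → dψ x ≤ 0

lemma W_antitone {x y : ℝ} (hx : 0 ≤ x) (hxy : x ≤ y) (hy : y ≤ 1) : W y ≤ W x := by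
  unfold W
  have h1 : x ^ 2 ≤ y ^ 2 := by gcongr
  have h2 : y ^ 2 ≤ 1 := by nlinarith
  nlinarith

lemma W_monotone {x y : ℝ} (hx : 1 ≤ x) (hxy : x ≤ y) : W x ≤ W y := by
  unfold W
  have h1 : x ^ 2 ≤ y ^ 2 := by gcongr
  have h2 : 1 ≤ x ^ 2 := by nlinarith
  nlinarith

namespace IsHalfLinePair

variable {β E₀ E₁ : ℝ} {ψ₀ dψ₀ ψ₁ dψ₁ : ℝ → ℝ}

lemma deriv_nonpos_of_three_le (h : IsHalfLinePair β E₀ E₁ ψ₀ dψ₀ ψ₁ dψ₁) {x : ℝ} (hx : 3 ≤ x) :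
    dψ₀ x ≤ 0 :=
  h.sol₀.deriv_nonpos_of_three_le h.one_le h.energy₀_le (fun x _ => h.pos₀ x) h.mass₀ hx

/-- Between two points where the derivative increases there is a classically forbidden point. -/
lemma exists_potential_pos (h : IsHalfLinePair β E₀ E₁ ψ₀ dψ₀ ψ₁ dψ₁) {x y : ℝ} (hxy : x < y)
    (hd : dψ₀ x < dψ₀ y) : ∃ t, x < t ∧ t < y ∧ E₀ < β * W t := by
  obtain ⟨t, ht, hte⟩ := exists_hasDerivAt_eq_slope dψ₀ _ hxy
    h.sol₀.continuous_deriv.continuousOn fun x _ => h.sol₀.hasDerivAt_deriv x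
  refine ⟨t, ht.1, ht.2, ?_⟩
  have h1 : 0 < 2 * β * (β * W t - E₀) * ψ₀ t := by
    rw [hte]; exact div_pos (by linarith) (by linarith)
  have h2 := pos_of_mul_pos_left h1 (h.pos₀ t).le
  have h3 := pos_of_mul_pos_right h2 (by linarith [h.one_le])
  linarith

lemma exists_potential_neg (h : IsHalfLinePair β E₀ E₁ ψ₀ dψ₀ ψ₁ dψ₁) {x y : ℝ} (hxy : x < y)
    (hd : dψ₀ y < dψ₀ x) : ∃ t, x < t ∧ t < y ∧ β * W t < E₀ := by
  obtain ⟨t, ht, hte⟩ := exists_hasDerivAt_eq_slope dψ₀ _ hxy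
    h.sol₀.continuous_deriv.continuousOn fun x _ => h.sol₀.hasDerivAt_deriv x
  refine ⟨t, ht.1, ht.2, ?_⟩
  by_contra! hle
  have h1 : 0 ≤ 2 * β * (β * W t - E₀) * ψ₀ t := by
    have := h.one_le
    have := h.pos₀ t
    have : 0 ≤ β * W t - E₀ := by linarith
    positivity
  rw [hte] at h1
  exact absurd h1 (not_le.2 (div_neg_of_neg_of_pos (by linarith) (by linarith)))

lemma deriv_lt_deriv (h : IsHalfLinePair β E₀ E₁ ψ₀ dψ₀ ψ₁ dψ₁) {x y : ℝ} (hxy : x < y)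
    (hq : ∀ t, x < t → t < y → E₀ < β * W t) : dψ₀ x < dψ₀ y := by
  obtain ⟨t, ht, hte⟩ := exists_hasDerivAt_eq_slope dψ₀ _ hxy
    h.sol₀.continuous_deriv.continuousOn fun x _ => h.sol₀.hasDerivAt_deriv x
  have h1 : 0 < 2 * β * (β * W t - E₀) * ψ₀ t := by
    have := h.one_le
    have := h.pos₀ t
    have : 0 < β * W t - E₀ := by linarith [hq t ht.1 ht.2]
    positivity
  rw [hte, div_pos_iff_of_pos_right (by linarith)] at h1
  linarith

/-- The sign of `ψ₀''` is that of `β W - E₀`, and `W` decreases up to `1` and increases afterwards.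
A second change of monotonicity would make a whole neighbourhood of `0`, or of infinity, forbidden
in a way that `ψ₀' 0 = 0` or the decay excludes. -/
lemma exists_isPeak (h : IsHalfLinePair β E₀ E₁ ψ₀ dψ₀ ψ₁ dψ₁) : ∃ m, IsPeak dψ₀ m := by
  have hβ : 0 < β := by linarith [h.one_le]
  obtain ⟨m, hm, hmax⟩ := isCompact_Icc.exists_isMaxOn (s := Set.Icc (0 : ℝ) 3) (f := ψ₀)
    ⟨0, by simp⟩ h.sol₀.continuous.continuousOn
  have hanti : AntitoneOn ψ₀ (Set.Ici 3) :=
    antitoneOn_of_hasDerivAt_nonpos (convex_Ici 3) (fun x _ => h.sol₀.hasDerivAt x)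
      fun x hx => h.deriv_nonpos_of_three_le hx
  have hle : ∀ x, 0 ≤ x → ψ₀ x ≤ ψ₀ m := by
    intro x hx
    rcases le_total x 3 with h3 | h3
    · exact hmax ⟨hx, h3⟩
    · exact (hanti (Set.mem_Ici.2 le_rfl) (Set.mem_Ici.2 h3) h3).trans
        (hmax ⟨by norm_num, le_rfl⟩)
  have hdm : dψ₀ m = 0 := by
    rcases hm.1.eq_or_lt with h0 | h0
    · rw [← h0]; exact h.deriv_zero
    · refine IsLocalMax.hasDerivAt_eq_zero (f := ψ₀) ?_ (h.sol₀.hasDerivAt m)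
      filter_upwards [Ioi_mem_nhds h0] with x hx using hle x (le_of_lt hx)
  refine ⟨m, hm.1, hm.2, fun x hx hxm => ?_, fun x hxm => ?_⟩
  -- A descent before `m` gives an allowed point followed by a forbidden one `t < m`. So `t > 1`,
  -- everything beyond `t` is forbidden, and `ψ₀'` grows from `0` at `m`, against `ψ₀' 4 ≤ 0`.
  · by_contra! hneg
    have hx0 : 0 < x := hx.lt_of_ne fun e => by rw [← e, h.deriv_zero] at hneg; exact lt_irrefl _ hneg
    have hxm' : x < m := hxm.lt_of_ne fun e => by rw [e, hdm] at hneg; exact lt_irrefl _ hneg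
    obtain ⟨s, hs0, hsx, hs⟩ := h.exists_potential_neg hx0 (by rw [h.deriv_zero]; exact hneg)
    obtain ⟨t, htx, htm, ht⟩ := h.exists_potential_pos hxm' (by rw [hdm]; exact hneg)
    have ht1 : 1 < t := by
      by_contra! ht1
      have := mul_le_mul_of_nonneg_left (W_antitone hs0.le (by linarith) ht1) hβ.le
      linarith
    have h4 := h.deriv_lt_deriv (x := m) (y := 4) (by linarith [hm.2]) fun y hy _ => by
      have := mul_le_mul_of_nonneg_left (W_monotone ht1.le (by linarith : t ≤ y)) hβ.le
      linarith
    linarith [h.deriv_nonpos_of_three_le (x := 4) (by norm_num)]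
  -- An ascent after `m` gives a forbidden point `s > m` followed by an allowed one. So `s < 1` and
  -- all of `(0, s)` is forbidden, whence `ψ₀' > 0` there, which contradicts maximality at `m`.
  · by_contra! hpos
    have hxm' : m < x := hxm.lt_of_ne fun e => by rw [← e, hdm] at hpos; exact lt_irrefl _ hpos
    have hx3 : x < 3 := by
      by_contra! hx3
      linarith [h.deriv_nonpos_of_three_le hx3]
    obtain ⟨s, hsm, hsx, hs⟩ := h.exists_potential_pos hxm' (by rw [hdm]; exact hpos)
    obtain ⟨t, htx, ht3, ht⟩ := h.exists_potential_neg hx3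
      ((h.deriv_nonpos_of_three_le le_rfl).trans_lt hpos)
    have hs1 : s < 1 := by
      by_contra! hs1
      have := mul_le_mul_of_nonneg_left (W_monotone hs1 (by linarith : s ≤ t)) hβ.le
      linarith
    have hq : ∀ y, 0 < y → y < s → E₀ < β * W y := fun y hy hys => by
      have := mul_le_mul_of_nonneg_left (W_antitone hy.le hys.le hs1.le) hβ.le
      linarith
    rcases hm.1.eq_or_lt with h0 | h0
    · obtain ⟨y, hy, hye⟩ := exists_hasDerivAt_eq_slope ψ₀ dψ₀ (by linarith : m < s)
        h.sol₀.continuous.continuousOn fun x _ => h.sol₀.hasDerivAt x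
      have h1 := h.deriv_lt_deriv (x := 0) (y := y) (by linarith [hy.1]) fun z hz hzy =>
        hq z hz (by linarith [hy.2])
      rw [h.deriv_zero, hye, div_pos_iff_of_pos_right (by linarith)] at h1
      linarith [hle s (by linarith)]
    · have h1 := h.deriv_lt_deriv (x := 0) (y := m) h0 fun z hz hzy => hq z hz (by linarith)
      rw [h.deriv_zero, hdm] at h1
      exact lt_irrefl _ h1

end IsHalfLinePair
end DoubleWell

/-! ### Oscillation of the quotient, its value at the peak, and part (a). -/

namespace DoubleWell
namespace IsHalfLinePair

variable {β E₀ E₁ m : ℝ} {ψ₀ dψ₀ ψ₁ dψ₁ : ℝ → ℝ}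

lemma monotoneOn_of_isPeak (h : IsHalfLinePair β E₀ E₁ ψ₀ dψ₀ ψ₁ dψ₁) (hm : IsPeak dψ₀ m) :
    MonotoneOn ψ₀ (Set.Icc 0 m) :=
  monotoneOn_of_hasDerivAt_nonneg (convex_Icc 0 m) (fun x _ => h.sol₀.hasDerivAt x)
    fun x hx => hm.deriv_nonneg x hx.1 hx.2

lemma antitoneOn_of_isPeak (h : IsHalfLinePair β E₀ E₁ ψ₀ dψ₀ ψ₁ dψ₁) (hm : IsPeak dψ₀ m) :
    AntitoneOn ψ₀ (Set.Ici m) :=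
  antitoneOn_of_hasDerivAt_nonpos (convex_Ici m) (fun x _ => h.sol₀.hasDerivAt x)
    fun x hx => hm.deriv_nonpos x hx

lemma le_peak (h : IsHalfLinePair β E₀ E₁ ψ₀ dψ₀ ψ₁ dψ₁) (hm : IsPeak dψ₀ m) {x : ℝ} (hx : 0 ≤ x) :
    ψ₀ x ≤ ψ₀ m := by
  rcases le_total x m with hxm | hxm
  · exact h.monotoneOn_of_isPeak hm ⟨hx, hxm⟩ ⟨hm.nonneg, le_rfl⟩ hxm
  · exact h.antitoneOn_of_isPeak hm (Set.mem_Ici.2 le_rfl) hxm hxm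

/-- Past the peak `ψ₀` decreases, so the mass up to `3` is at most `3 ψ₀ x ^ 2`, and the mass beyond
`3` adds at most half of `ψ₀ x ^ 2`. -/
lemma tail_le_sq (h : IsHalfLinePair β E₀ E₁ ψ₀ dψ₀ ψ₁ dψ₁) (hm : IsPeak dψ₀ m) {x : ℝ}
    (hx : m ≤ x) : tail ψ₀ x ≤ 4 * ψ₀ x ^ 2 := by
  have hT : ∀ y, 3 ≤ y → tail ψ₀ y ≤ ψ₀ y ^ 2 / 2 := fun y hy =>
    h.sol₀.tail_le_of_three_le h.one_le h.energy₀_le (fun x _ => h.pos₀ x) h.mass₀ hy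
  rcases le_total 3 x with h3 | h3
  · nlinarith [hT x h3, sq_nonneg (ψ₀ x)]
  have hmono : ∀ y, x ≤ y → ψ₀ y ^ 2 ≤ ψ₀ x ^ 2 := fun y hy =>
    pow_le_pow_left₀ (h.pos₀ y).le (h.antitoneOn_of_isPeak hm hx (Set.mem_Ici.2 (hx.trans hy)) hy) 2
  have h1 : ∫ t in x..3, ψ₀ t ^ 2 ≤ ∫ t in x..3, ψ₀ x ^ 2 :=
    intervalIntegral.integral_mono_on h3
      ((h.sol₀.continuous.pow 2).intervalIntegrable _ _) (by simp) fun t ht => hmono t ht.1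
  rw [integral_sq_eq_tail_sub_tail h.sol₀.continuous, intervalIntegral.integral_const,
    smul_eq_mul] at h1
  have h2 := hT 3 le_rfl
  have h4 := hmono 3 h3
  have h5 : 0 ≤ x := hm.nonneg.trans hx
  nlinarith [mul_nonneg h5 (sq_nonneg (ψ₀ x))]

/-- Oscillation away from the peak of a function whose derivative is `g / ψ₀²`. -/
lemma sq_mul_abs_sub_le (h : IsHalfLinePair β E₀ E₁ ψ₀ dψ₀ ψ₁ dψ₁) (hm : IsPeak dψ₀ m)
    {G g : ℝ → ℝ} {K : ℝ} (hG : ∀ x, HasDerivAt G (g x / ψ₀ x ^ 2) x) (hg : Continuous g)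
    (hg0 : ∀ x, 0 ≤ x → 0 ≤ g x) (hK : ∀ a b, 0 ≤ a → a ≤ b → ∫ x in a..b, g x ≤ K) {x : ℝ}
    (hx : 0 ≤ x) : ψ₀ x ^ 2 * |G x - G m| ≤ K := by
  have hGm : MonotoneOn G (Set.Ici 0) :=
    monotoneOn_of_hasDerivAt_nonneg (convex_Ici 0) (fun x _ => hG x)
      fun x hx => div_nonneg (hg0 x hx) (sq_nonneg _)
  -- Between `x` and the peak, `ψ₀ ≥ ψ₀ x`, hence `ψ₀ x ^ 2 * G' ≤ g`.
  have key : ∀ a b, 0 ≤ a → a ≤ b → (∀ y, a ≤ y → y ≤ b → ψ₀ x ≤ ψ₀ y) →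
      ψ₀ x ^ 2 * (G b - G a) ≤ K := by
    intro a b ha hab hy
    have hmono : MonotoneOn (fun y => (∫ t in a..y, g t) - ψ₀ x ^ 2 * G y) (Set.Icc a b) := by
      refine monotoneOn_of_hasDerivAt_nonneg (convex_Icc a b)
        (fun y _ => (hasDerivAt_integral_of_continuous hg a y).sub ((hG y).const_mul (ψ₀ x ^ 2))) ?_
      intro y hyI
      have h1 : ψ₀ x ^ 2 ≤ ψ₀ y ^ 2 := pow_le_pow_left₀ (h.pos₀ x).le (hy y hyI.1 hyI.2) 2
      have h2 := hg0 y (ha.trans hyI.1)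
      have h3 : 0 < ψ₀ y ^ 2 := pow_pos (h.pos₀ y) 2
      have h4 : ψ₀ x ^ 2 * (g y / ψ₀ y ^ 2) ≤ g y := by
        rw [← mul_div_assoc, div_le_iff₀ h3]; nlinarith
      linarith
    have h1 := hmono (Set.left_mem_Icc.2 hab) (Set.right_mem_Icc.2 hab) hab
    simp only [intervalIntegral.integral_same] at h1
    linarith [hK a b ha hab]
  rcases le_total x m with hxm | hxm
  · rw [abs_sub_comm, abs_of_nonneg (sub_nonneg.2 (hGm hx hm.nonneg hxm))]
    exact key x m hx hxm fun y h1 h2 =>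
      h.monotoneOn_of_isPeak hm ⟨hx, hxm⟩ ⟨hx.trans h1, h2⟩ h1
  · rw [abs_of_nonneg (sub_nonneg.2 (hGm hm.nonneg hx hxm))]
    exact key m x hm.nonneg hxm fun y h1 h2 => h.antitoneOn_of_isPeak hm h1 hxm h2

lemma sq_mul_abs_ratio_sub_le (h : IsHalfLinePair β E₀ E₁ ψ₀ dψ₀ ψ₁ dψ₁) (hm : IsPeak dψ₀ m)
    {x : ℝ} (hx : 0 ≤ x) :
    ψ₀ x ^ 2 * |ratio ψ₀ ψ₁ x - ratio ψ₀ ψ₁ m| ≤ 4 * (β * (E₁ - E₀)) :=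
  h.sq_mul_abs_sub_le hm h.hasDerivAt_ratio h.continuous_wronskian
    (fun _ hx => h.wronskian_nonneg hx) (fun _ _ ha hab => h.integral_wronskian_le ha hab) hx

lemma hasDerivAt_ratio_sq (h : IsHalfLinePair β E₀ E₁ ψ₀ dψ₀ ψ₁ dψ₁) (x : ℝ) :
    HasDerivAt (fun x => ratio ψ₀ ψ₁ x ^ 2)
      (2 * ratio ψ₀ ψ₁ x * wronskian ψ₀ dψ₀ ψ₁ dψ₁ x / ψ₀ x ^ 2) x := by
  refine ((h.hasDerivAt_ratio x).pow 2).congr_deriv ?_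
  simp; ring

lemma sq_mul_abs_ratio_sq_sub_le (h : IsHalfLinePair β E₀ E₁ ψ₀ dψ₀ ψ₁ dψ₁) (hm : IsPeak dψ₀ m)
    {x : ℝ} (hx : 0 ≤ x) :
    ψ₀ x ^ 2 * |ratio ψ₀ ψ₁ x ^ 2 - ratio ψ₀ ψ₁ m ^ 2| ≤ 8 * (β * (E₁ - E₀)) := by
  have c0 := h.continuous_wronskian
  have c1 := h.continuous_ratio
  refine h.sq_mul_abs_sub_le hm h.hasDerivAt_ratio_sq (by fun_prop)
    (fun x hx => ?_) (fun _ _ ha hab => h.integral_ratio_mul_wronskian_le ha hab) hx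
  have := h.wronskian_nonneg hx
  have := h.ratio_nonneg hx
  positivity

/-- The left side is the integral of `(r² - (r m)²) ψ₀²` over `[m, ∞)`. Integration by parts turns
it into that of `(r²)' * tail ψ₀`, which `tail_le_sq` bounds by `4 ∫ 2 r w ≤ 32 ε`. The boundary
term at infinity has a favourable sign and is dropped. -/
lemma tail_sub_le (h : IsHalfLinePair β E₀ E₁ ψ₀ dψ₀ ψ₁ dψ₁) (hm : IsPeak dψ₀ m) :
    tail ψ₁ m - ratio ψ₀ ψ₁ m ^ 2 * tail ψ₀ m ≤ 32 * (β * (E₁ - E₀)) := by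
  have c0 := h.continuous_wronskian
  have c1 := h.continuous_ratio
  have hmono : MonotoneOn (fun y => 4 * (∫ t in m..y, 2 * ratio ψ₀ ψ₁ t * wronskian ψ₀ dψ₀ ψ₁ dψ₁ t)
      + (tail ψ₁ y - ratio ψ₀ ψ₁ y ^ 2 * tail ψ₀ y)) (Set.Ici m) := by
    refine monotoneOn_of_hasDerivAt_nonneg (convex_Ici m)
      (fun y _ => ((hasDerivAt_integral_of_continuous
        (f := fun t => 2 * ratio ψ₀ ψ₁ t * wronskian ψ₀ dψ₀ ψ₁ dψ₁ t) (by fun_prop) m y).const_mul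
        4).add ((hasDerivAt_tail h.sol₁.continuous y).sub
        ((h.hasDerivAt_ratio_sq y).mul (hasDerivAt_tail h.sol₀.continuous y)))) ?_
    intro y hy
    have hy0 : 0 ≤ y := hm.nonneg.trans hy
    have h1 := h.wronskian_nonneg hy0
    have h2 := h.ratio_nonneg hy0
    have h3 : 0 < ψ₀ y ^ 2 := pow_pos (h.pos₀ y) 2
    have h4 := h.tail_le_sq hm hy
    have h5 : 0 ≤ 2 * ratio ψ₀ ψ₁ y * wronskian ψ₀ dψ₀ ψ₁ dψ₁ y := by positivity
    have h6 : 2 * ratio ψ₀ ψ₁ y * wronskian ψ₀ dψ₀ ψ₁ dψ₁ y / ψ₀ y ^ 2 * tail ψ₀ y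
        ≤ 4 * (2 * ratio ψ₀ ψ₁ y * wronskian ψ₀ dψ₀ ψ₁ dψ₁ y) := by
      rw [div_mul_eq_mul_div, div_le_iff₀ h3]; nlinarith
    have h7 : ψ₁ y ^ 2 = ratio ψ₀ ψ₁ y ^ 2 * ψ₀ y ^ 2 := by rw [← mul_pow, h.ratio_mul]
    linarith
  refine ge_of_tendsto' (x := atTop) (f := fun n : ℝ => 32 * (β * (E₁ - E₀)) + tail ψ₁ (max n m)) ?_ ?_
  · have := (tendsto_tail h.mass₁).comp (tendsto_atTop_mono (fun n => le_max_left n m) tendsto_id)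
    simpa using this.const_add (32 * (β * (E₁ - E₀)))
  · intro n
    have hy : m ≤ max n m := le_max_right _ _
    have h1 := hmono (Set.mem_Ici.2 le_rfl) hy hy
    simp only [intervalIntegral.integral_same] at h1
    have h2 := h.integral_ratio_mul_wronskian_le hm.nonneg hy
    have h3 := mul_nonneg (sq_nonneg (ratio ψ₀ ψ₁ (max n m)))
      (tail_nonneg h.sol₀.continuous h.mass₀ (max n m))
    linarith

lemma le_tail_sub (h : IsHalfLinePair β E₀ E₁ ψ₀ dψ₀ ψ₁ dψ₁) {x : ℝ} (hx : 0 ≤ x) :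
    0 ≤ tail ψ₁ x - ratio ψ₀ ψ₁ x ^ 2 * tail ψ₀ x := by
  have hanti : AntitoneOn (fun y => tail ψ₁ y - ratio ψ₀ ψ₁ x ^ 2 * tail ψ₀ y) (Set.Ici x) := by
    refine antitoneOn_of_hasDerivAt_nonpos (convex_Ici x)
      (fun y _ => (hasDerivAt_tail h.sol₁.continuous y).sub
        ((hasDerivAt_tail h.sol₀.continuous y).const_mul (ratio ψ₀ ψ₁ x ^ 2))) ?_
    intro y hy
    have h1 : ratio ψ₀ ψ₁ x ^ 2 ≤ ratio ψ₀ ψ₁ y ^ 2 :=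
      pow_le_pow_left₀ (h.ratio_nonneg hx) (h.monotoneOn_ratio hx (Set.mem_Ici.2 (hx.trans hy)) hy) 2
    have h7 : ψ₁ y ^ 2 = ratio ψ₀ ψ₁ y ^ 2 * ψ₀ y ^ 2 := by rw [← mul_pow, h.ratio_mul]
    nlinarith [mul_le_mul_of_nonneg_right h1 (sq_nonneg (ψ₀ y))]
  have hlim : Tendsto (fun y => tail ψ₁ y - ratio ψ₀ ψ₁ x ^ 2 * tail ψ₀ y) atTop (𝓝 0) := by
    simpa using (tendsto_tail h.mass₁).sub ((tendsto_tail h.mass₀).const_mul (ratio ψ₀ ψ₁ x ^ 2))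
  refine le_of_tendsto hlim ?_
  filter_upwards [eventually_ge_atTop x] with y hy
  exact hanti (Set.mem_Ici.2 le_rfl) hy hy

/-- With `ρ = r m`, equality of the masses says that `(ρ² - 1) / 2` is the integral of `ρ² ψ₀² -
ψ₁²` over `[0, m]` minus `tail ψ₁ m - ρ² tail ψ₀ m`. These two terms lie in `[0, 24 ε]` and `[0, 32
ε]`, and `|1 - ρ| ≤ |1 - ρ²|`. -/
lemma abs_one_sub_ratio_peak_le (h : IsHalfLinePair β E₀ E₁ ψ₀ dψ₀ ψ₁ dψ₁) (hm : IsPeak dψ₀ m) :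
    |1 - ratio ψ₀ ψ₁ m| ≤ 64 * (β * (E₁ - E₀)) := by
  have c0 := h.sol₀.continuous
  have c1 := h.continuous_ratio
  have c2 := h.sol₁.continuous
  set ρ := ratio ψ₀ ψ₁ m with hρ
  have hρ0 : 0 ≤ ρ := h.ratio_nonneg hm.nonneg
  have hΔ := h.mul_gap_pos
  have hsq : ∀ y, ψ₁ y ^ 2 = ratio ψ₀ ψ₁ y ^ 2 * ψ₀ y ^ 2 := fun y => by
    rw [← mul_pow, h.ratio_mul]
  have e1 : ∫ t in (0 : ℝ)..m, (ρ ^ 2 * ψ₀ t ^ 2 - ψ₁ t ^ 2)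
      = ρ ^ 2 * (1 / 2 - tail ψ₀ m) - (1 / 2 - tail ψ₁ m) := by
    rw [intervalIntegral.integral_sub, intervalIntegral.integral_const_mul]
    · simp only [tail]; ring
    · exact Continuous.intervalIntegrable (by fun_prop) _ _
    · exact Continuous.intervalIntegrable (by fun_prop) _ _
  have hle : ∫ t in (0 : ℝ)..m, (ρ ^ 2 * ψ₀ t ^ 2 - ψ₁ t ^ 2) ≤ 24 * (β * (E₁ - E₀)) := by
    calc _ ≤ ∫ t in (0 : ℝ)..m, 8 * (β * (E₁ - E₀)) := by
          refine intervalIntegral.integral_mono_on hm.nonneg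
            (Continuous.intervalIntegrable (by fun_prop) _ _) (by simp) fun t ht => ?_
          have h1 := h.sq_mul_abs_ratio_sq_sub_le hm ht.1
          have h2 := mul_le_mul_of_nonneg_left
            (neg_abs_le (ratio ψ₀ ψ₁ t ^ 2 - ρ ^ 2)) (sq_nonneg (ψ₀ t))
          rw [hsq]
          linarith
      _ ≤ _ := by
          rw [intervalIntegral.integral_const, smul_eq_mul]
          nlinarith [hm.le_three]
  have hge : 0 ≤ ∫ t in (0 : ℝ)..m, (ρ ^ 2 * ψ₀ t ^ 2 - ψ₁ t ^ 2) := by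
    refine intervalIntegral.integral_nonneg hm.nonneg fun t ht => ?_
    have h1 : ratio ψ₀ ψ₁ t ^ 2 ≤ ρ ^ 2 :=
      pow_le_pow_left₀ (h.ratio_nonneg ht.1) (h.monotoneOn_ratio ht.1 hm.nonneg ht.2) 2
    rw [hsq]
    nlinarith [mul_le_mul_of_nonneg_right h1 (sq_nonneg (ψ₀ t))]
  have h1 := h.tail_sub_le hm
  have h2 := h.le_tail_sub hm.nonneg
  rw [← hρ] at h1 h2
  rw [e1] at hle hge
  have h3 : 1 - ρ ^ 2 ≤ 64 * (β * (E₁ - E₀)) := by linarith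
  have h4 : -(64 * (β * (E₁ - E₀))) ≤ 1 - ρ ^ 2 := by linarith
  refine abs_le.2 ⟨?_, ?_⟩
  · by_cases hc : ρ ≤ 1
    · linarith
    · nlinarith
  · by_cases hc : ρ ≤ 1
    · nlinarith
    · linarith

/-- Since `ψ₀'' ≥ -12 β ψ₀ m`, the ground state stays above `ψ₀ m / 2` on an interval of length `1 /
(4 √β)` to the right of `m`, whose mass is at most `1/2`. -/
lemma peak_sq_le (h : IsHalfLinePair β E₀ E₁ ψ₀ dψ₀ ψ₁ dψ₁) (hm : IsPeak dψ₀ m) :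
    ψ₀ m ^ 2 ≤ 8 * Real.sqrt β := by
  have hβ := h.one_le
  have hd0 : dψ₀ m = 0 :=
    le_antisymm (hm.deriv_nonpos m le_rfl) (hm.deriv_nonneg m hm.nonneg le_rfl)
  have hd : MonotoneOn (fun x => dψ₀ x + 12 * β * ψ₀ m * (x - m)) (Set.Ici m) := by
    refine monotoneOn_of_hasDerivAt_nonneg (convex_Ici m) (fun x _ => (h.sol₀.hasDerivAt_deriv x).add
      (((hasDerivAt_id x).sub_const m).const_mul (12 * β * ψ₀ m))) ?_
    intro x hx
    have hx0 := hm.nonneg.trans hx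
    have h1 : -6 ≤ β * W x - E₀ := by
      have : 0 ≤ β * W x := mul_nonneg (by linarith) (by unfold W; positivity)
      linarith [h.energy₀_le]
    have h2 := h.le_peak hm hx0
    have h3 := h.pos₀ x
    have h4 : 2 * β * (-6) * ψ₀ x ≤ 2 * β * (β * W x - E₀) * ψ₀ x := by gcongr
    nlinarith [mul_le_mul_of_nonneg_left h2 (by linarith : 0 ≤ 12 * β)]
  have hψ : MonotoneOn (fun x => ψ₀ x + 6 * β * ψ₀ m * (x - m) ^ 2) (Set.Ici m) := by
    refine monotoneOn_of_hasDerivAt_nonneg (convex_Ici m) (fun x _ => (h.sol₀.hasDerivAt x).add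
      ((((hasDerivAt_id x).sub_const m).pow 2).const_mul (6 * β * ψ₀ m))) ?_
    intro x hx
    have := hd (Set.mem_Ici.2 le_rfl) hx hx
    simp only [hd0, sub_self, mul_zero, add_zero] at this
    simp only [id, Nat.cast_ofNat, Nat.add_one_sub_one, pow_one]
    linarith
  set s := Real.sqrt β with hs
  have hs1 : 1 ≤ s := Real.one_le_sqrt.2 hβ
  have hs2 : s ^ 2 = β := Real.sq_sqrt (by linarith)
  have hsi : s * s⁻¹ = 1 := mul_inv_cancel₀ (by linarith)
  have hsi0 : 0 < s⁻¹ := by positivity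
  have hlow : ∀ x ∈ Set.Icc m (m + s⁻¹ / 4), (ψ₀ m / 2) ^ 2 ≤ ψ₀ x ^ 2 := by
    intro x hx
    have h1 := hψ (Set.mem_Ici.2 le_rfl) (Set.mem_Ici.2 hx.1) hx.1
    simp only [sub_self] at h1
    have h2 : (x - m) ^ 2 ≤ (s⁻¹ / 4) ^ 2 :=
      pow_le_pow_left₀ (by linarith [hx.1]) (by linarith [hx.2]) 2
    have h3 : β * (x - m) ^ 2 ≤ 1 / 16 := by
      have := mul_le_mul_of_nonneg_left h2 (by linarith : 0 ≤ β)
      have e : β * (s⁻¹ / 4) ^ 2 = 1 / 16 := by rw [← hs2]; field_simp; norm_num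
      linarith
    have h4 := h.pos₀ m
    refine pow_le_pow_left₀ (by linarith) ?_ 2
    nlinarith [mul_le_mul_of_nonneg_left h3 h4.le]
  have hint : ∫ t in m..(m + s⁻¹ / 4), (ψ₀ m / 2) ^ 2 ≤ ∫ t in m..(m + s⁻¹ / 4), ψ₀ t ^ 2 :=
    intervalIntegral.integral_mono_on (by linarith) (by simp)
      ((h.sol₀.continuous.pow 2).intervalIntegrable _ _) hlow
  rw [integral_sq_eq_tail_sub_tail h.sol₀.continuous, intervalIntegral.integral_const,
    smul_eq_mul] at hint
  have h1 := antitone_tail h.sol₀.continuous hm.nonneg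
  rw [tail_zero] at h1
  have h2 := tail_nonneg h.sol₀.continuous h.mass₀ (m + s⁻¹ / 4)
  have h3 : s⁻¹ * ψ₀ m ^ 2 ≤ 8 := by linarith
  have h4 := mul_le_mul_of_nonneg_left h3 (by linarith : 0 ≤ s)
  rw [← mul_assoc, hsi, one_mul] at h4
  linarith

/-- The pointwise comparison of the first two eigenfunctions. -/
theorem mul_abs_sub_le (h : IsHalfLinePair β E₀ E₁ ψ₀ dψ₀ ψ₁ dψ₁) {x : ℝ} (hx : 0 ≤ x) :
    ψ₀ x * |ψ₀ x - ψ₁ x| ≤ 516 * β ^ (3 / 2 : ℝ) * (E₁ - E₀) := by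
  obtain ⟨m, hm⟩ := h.exists_isPeak
  have hβ := h.one_le
  have hΔ := h.mul_gap_pos
  have e1 : ψ₀ x * |ψ₀ x - ψ₁ x| = ψ₀ x ^ 2 * |1 - ratio ψ₀ ψ₁ x| := by
    have : ψ₀ x - ψ₁ x = ψ₀ x * (1 - ratio ψ₀ ψ₁ x) := by rw [← h.ratio_mul x]; ring
    rw [this, abs_mul, abs_of_pos (h.pos₀ x)]; ring
  have e2 : β ^ (3 / 2 : ℝ) = Real.sqrt β * β := by
    rw [Real.sqrt_eq_rpow, ← Real.rpow_add_one (by linarith)]; norm_num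
  have hs1 : 1 ≤ Real.sqrt β := Real.one_le_sqrt.2 hβ
  have h1 := h.sq_mul_abs_ratio_sub_le hm hx
  have h2 := h.abs_one_sub_ratio_peak_le hm
  have h3 : ψ₀ x ^ 2 ≤ 8 * Real.sqrt β :=
    (pow_le_pow_left₀ (h.pos₀ x).le (h.le_peak hm hx) 2).trans (h.peak_sq_le hm)
  have h4 : |1 - ratio ψ₀ ψ₁ x| ≤ |1 - ratio ψ₀ ψ₁ m| + |ratio ψ₀ ψ₁ x - ratio ψ₀ ψ₁ m| := by
    rw [abs_sub_comm (ratio ψ₀ ψ₁ x)]; exact abs_sub_le _ _ _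
  rw [e1, e2]
  -- The constant is `516 = 8 * 64 + 4`.
  calc ψ₀ x ^ 2 * |1 - ratio ψ₀ ψ₁ x|
      ≤ ψ₀ x ^ 2 * |1 - ratio ψ₀ ψ₁ m| + ψ₀ x ^ 2 * |ratio ψ₀ ψ₁ x - ratio ψ₀ ψ₁ m| := by
        rw [← mul_add]; gcongr
    _ ≤ 8 * Real.sqrt β * (64 * (β * (E₁ - E₀))) + 4 * (β * (E₁ - E₀)) := by gcongr
    _ ≤ 8 * Real.sqrt β * (64 * (β * (E₁ - E₀))) + Real.sqrt β * (4 * (β * (E₁ - E₀))) := by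
        nlinarith
    _ = 516 * (Real.sqrt β * β) * (E₁ - E₀) := by ring

end IsHalfLinePair
end DoubleWell

/-! ### A Harnack inequality and smallness of the scaled gap. -/

namespace DoubleWell

/-- A one-dimensional Harnack inequality for positive functions with `f'' ≤ k² f`. -/
lemma le_mul_exp_of_deriv_deriv_le {f f' f'' : ℝ → ℝ} {a b k x y : ℝ}
    (hf : ∀ t, HasDerivAt f (f' t) t) (hf' : ∀ t, HasDerivAt f' (f'' t) t) (hpos : ∀ t, 0 < f t)
    (hk : 0 ≤ k) (hle : ∀ t ∈ Set.Icc a b, f'' t ≤ k ^ 2 * f t) (hax : a < x) (hxy : x ≤ y)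
    (hyb : y ≤ b) : f y ≤ f x * Real.exp ((k + 1 / (x - a)) * (y - x)) := by
  have hE : ∀ t, HasDerivAt (fun t => Real.exp (k * (t - a))) (k * Real.exp (k * (t - a))) t := by
    intro t
    refine (((hasDerivAt_id t).sub_const a).const_mul k).exp.congr_deriv ?_
    simp [mul_comm]
  have hs : ∀ t, HasDerivAt (fun t => (t - a) * Real.exp (k * (t - a)))
      ((1 + k * (t - a)) * Real.exp (k * (t - a))) t := by
    intro t
    refine (((hasDerivAt_id t).sub_const a).mul (hE t)).congr_deriv ?_
    simp; ring
  have hs' : ∀ t, HasDerivAt (fun t => (1 + k * (t - a)) * Real.exp (k * (t - a)))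
      ((2 * k + k ^ 2 * (t - a)) * Real.exp (k * (t - a))) t := by
    intro t
    refine (((((hasDerivAt_id t).sub_const a).const_mul k).const_add 1).mul (hE t)).congr_deriv ?_
    simp; ring
  -- The comparison function `σ t = (t - a) * exp (k (t - a))` satisfies `σ'' ≥ k² σ` on `[a, b]`
  -- and `σ a = 0`. So `f' σ - f σ'` decreases from `-f a < 0`, giving `f' / f ≤ σ' / σ = k + 1 / (t
  -- - a)`.
  have hanti : AntitoneOn (fun t => f' t * ((t - a) * Real.exp (k * (t - a)))
      - f t * ((1 + k * (t - a)) * Real.exp (k * (t - a)))) (Set.Icc a b) := by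
    refine antitoneOn_of_hasDerivAt_nonpos (convex_Icc a b)
      (fun t _ => ((hf' t).mul (hs t)).sub ((hf t).mul (hs' t))) ?_
    intro t ht
    have h1 := hle t ht
    have h2 := Real.exp_pos (k * (t - a))
    have h3 : 0 ≤ (t - a) * Real.exp (k * (t - a)) := mul_nonneg (by linarith [ht.1]) h2.le
    have h4 := mul_le_mul_of_nonneg_right h1 h3
    have h5 := mul_nonneg (mul_nonneg hk (hpos t).le) h2.le
    linarith
  set c := k + 1 / (x - a) with hc
  have hder : ∀ t ∈ Set.Icc x y, f' t ≤ c * f t := by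
    intro t ht
    have hta : 0 < t - a := by linarith [ht.1]
    have h1 := hanti (Set.left_mem_Icc.2 (by linarith)) (Set.mem_Icc.2 ⟨by linarith, by linarith [ht.2]⟩)
      (by linarith : a ≤ t)
    simp only [sub_self, mul_zero, add_zero, Real.exp_zero, mul_one, zero_sub] at h1
    have h2 : (f' t * (t - a) - f t * (1 + k * (t - a))) * Real.exp (k * (t - a)) ≤ 0 := by
      linarith [hpos a]
    have h3 := nonpos_of_mul_nonpos_left h2 (Real.exp_pos _)
    have h4 : f' t ≤ (k + 1 / (t - a)) * f t := by
      have e : (k + 1 / (t - a)) * f t = f t * (1 + k * (t - a)) / (t - a) := by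
        field_simp; ring
      rw [e, le_div_iff₀ hta]; linarith
    refine h4.trans (mul_le_mul_of_nonneg_right ?_ (hpos t).le)
    rw [hc]
    gcongr
    exact ht.1
  have hfin : AntitoneOn (fun t => f t * Real.exp (-(c * (t - x)))) (Set.Icc x y) := by
    have hE' : ∀ t, HasDerivAt (fun t => Real.exp (-(c * (t - x)))) (-c * Real.exp (-(c * (t - x)))) t := by
      intro t
      refine (((hasDerivAt_id t).sub_const x).const_mul c).fun_neg.exp.congr_deriv ?_
      simp [mul_comm]
    refine antitoneOn_of_hasDerivAt_nonpos (convex_Icc x y) (fun t _ => (hf t).mul (hE' t)) ?_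
    intro t ht
    nlinarith [mul_le_mul_of_nonneg_right (hder t ht) (Real.exp_pos (-(c * (t - x)))).le]
  have h1 := hfin (Set.left_mem_Icc.2 hxy) (Set.right_mem_Icc.2 hxy) hxy
  simp only [sub_self, mul_zero, neg_zero, Real.exp_zero, mul_one, Real.exp_neg] at h1
  rwa [← div_eq_mul_inv, div_le_iff₀ (Real.exp_pos _)] at h1

/-- The potential is controlled on the doubled window, so `x` keeps distance `L / s` from its left
end. The exponent is then at most `(6 L s + s / L) * (2 L / s)`. -/
lemma IsSolution.le_mul_exp {β E L s c x y : ℝ} {f df : ℝ → ℝ} (h : IsSolution β E f df)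
    (hpos : ∀ t, 0 < f t) (hs : 0 < s) (hL : 0 < L)
    (hq : ∀ t, s * |t - c| ≤ 2 * L → 2 * β * (β * W t - E) ≤ (6 * L * s) ^ 2)
    (hx : s * |x - c| ≤ L) (hy : s * |y - c| ≤ L) (hxy : x ≤ y) :
    f y ≤ Real.exp (12 * L ^ 2 + 2) * f x := by
  have hbox : ∀ t M : ℝ, s * |t - c| ≤ M ↔ c - M / s ≤ t ∧ t ≤ c + M / s := by
    intro t M
    rw [mul_comm, ← le_div_iff₀ hs, abs_le]
    constructor <;> rintro ⟨h1, h2⟩ <;> constructor <;> linarith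
  have hx' := (hbox x L).1 hx
  have hy' := (hbox y L).1 hy
  have hLs : 0 < L / s := by positivity
  have hdouble : 2 * L / s = 2 * (L / s) := by ring
  have key := le_mul_exp_of_deriv_deriv_le (a := c - 2 * L / s) (b := c + 2 * L / s)
    (k := 6 * L * s) h.hasDerivAt h.hasDerivAt_deriv hpos (by positivity) (fun t ht =>
      mul_le_mul_of_nonneg_right (hq t ((hbox t (2 * L)).2 ht)) (hpos t).le)
    (by linarith [hx'.1]) hxy (by linarith [hy'.2])
  rw [mul_comm (f x)] at key
  refine key.trans (mul_le_mul_of_nonneg_right (Real.exp_le_exp.2 ?_) (hpos x).le)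
  have h1 : 1 / (x - (c - 2 * L / s)) ≤ s / L := by
    rw [div_le_div_iff₀ (by linarith [hx'.1]) hL]
    have : s * (L / s) ≤ s * (x - (c - 2 * L / s)) :=
      mul_le_mul_of_nonneg_left (by linarith [hx'.1]) hs.le
    rw [mul_div_cancel₀ _ hs.ne'] at this
    linarith
  calc (6 * L * s + 1 / (x - (c - 2 * L / s))) * (y - x)
      ≤ (6 * L * s + s / L) * (2 * L / s) := by
        gcongr
        linarith [hx'.1, hy'.2]
    _ = 12 * L ^ 2 + 2 := by field_simp; ring

namespace IsHalfLinePair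

variable {β E₀ E₁ m : ℝ} {ψ₀ dψ₀ ψ₁ dψ₁ : ℝ → ℝ}

/-- A strictly convex function has no peak, so `m` is classically allowed; this localises it within
`O(β^(-1/2))` of `1`. -/
lemma potential_peak_le (h : IsHalfLinePair β E₀ E₁ ψ₀ dψ₀ ψ₁ dψ₁) (hm : IsPeak dψ₀ m) :
    β * W m ≤ E₀ := by
  by_contra! hlt
  have hc : Continuous fun t => β * W t := continuous_const.mul continuous_W
  obtain ⟨ε, hε, hball⟩ := Metric.eventually_nhds_iff.1 (hc.continuousAt.eventually_const_lt hlt)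
  have h1 := h.deriv_lt_deriv (x := m) (y := m + ε) (by linarith) fun t h1 h2 =>
    hball (by rw [Real.dist_eq, abs_lt]; constructor <;> linarith)
  linarith [hm.deriv_nonneg m hm.nonneg le_rfl, hm.deriv_nonpos (m + ε) (by linarith)]

lemma energy₀_nonneg (h : IsHalfLinePair β E₀ E₁ ψ₀ dψ₀ ψ₁ dψ₁) : 0 ≤ E₀ := by
  obtain ⟨m, hm⟩ := h.exists_isPeak
  have h1 : 0 ≤ β * W m := mul_nonneg (by linarith [h.one_le]) (by unfold W; positivity)
  linarith [h.potential_peak_le hm]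

lemma mul_peak_sub_one_sq_le (h : IsHalfLinePair β E₀ E₁ ψ₀ dψ₀ ψ₁ dψ₁) (hm : IsPeak dψ₀ m) :
    β * (m - 1) ^ 2 ≤ 12 := by
  have h1 : (m - 1) ^ 2 / 2 ≤ W m := by
    have e : W m = (m - 1) ^ 2 * (m + 1) ^ 2 / 2 := by unfold W; ring
    have : 1 ≤ (m + 1) ^ 2 := by nlinarith [hm.nonneg]
    rw [e]; nlinarith [sq_nonneg (m - 1)]
  have h2 := mul_le_mul_of_nonneg_left h1 (by linarith [h.one_le] : 0 ≤ β)
  linarith [h.potential_peak_le hm, h.energy₀_le]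

lemma sqrt_mul_abs_peak_sub_one_le (h : IsHalfLinePair β E₀ E₁ ψ₀ dψ₀ ψ₁ dψ₁)
    (hm : IsPeak dψ₀ m) : Real.sqrt β * |m - 1| ≤ 4 := by
  refine abs_le_of_sq_le_sq' ?_ (by norm_num) |>.2
  rw [mul_pow, Real.sq_sqrt (by linarith [h.one_le]), sq_abs]
  linarith [h.mul_peak_sub_one_sq_le hm]

/-- Near the bottom of the well the ground state is comparable to its maximum. -/
lemma peak_le_exp_mul (h : IsHalfLinePair β E₀ E₁ ψ₀ dψ₀ ψ₁ dψ₁) (hm : IsPeak dψ₀ m) {L x : ℝ}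
    (hL : 4 ≤ L) (hβL : 2 * L ≤ Real.sqrt β) (hx : Real.sqrt β * |x - 1| ≤ L) :
    ψ₀ m ≤ Real.exp (12 * L ^ 2 + 2) * ψ₀ x := by
  set s := Real.sqrt β with hs
  have hβ := h.one_le
  have hs2 : s ^ 2 = β := Real.sq_sqrt (by linarith)
  have hs0 : 0 < s := by linarith
  have hm' : s * |m - 1| ≤ L := (h.sqrt_mul_abs_peak_sub_one_le hm).trans hL
  -- Here `2 L ≤ √β` keeps `|t - 1| ≤ 1`, so `(t + 1)² ≤ 9` and the bound is `s² * (2 L)² * 9`.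
  have hq : ∀ t, s * |t - 1| ≤ 2 * L → 2 * β * (β * W t - E₀) ≤ (6 * L * s) ^ 2 := by
    intro t ht
    have h1 : |t - 1| ≤ 1 := by
      have : s * |t - 1| ≤ s * 1 := by linarith
      exact le_of_mul_le_mul_left this hs0
    obtain ⟨h2, h3⟩ := abs_le.1 h1
    have h4 : (s * |t - 1|) ^ 2 ≤ (2 * L) ^ 2 := pow_le_pow_left₀ (by positivity) ht 2
    have h5 : (t + 1) ^ 2 ≤ 9 := by nlinarith
    have h6 : (s * |t - 1|) ^ 2 * (t + 1) ^ 2 ≤ (2 * L) ^ 2 * 9 := by gcongr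
    have e : 2 * β * (β * W t) = s ^ 2 * ((s * |t - 1|) ^ 2 * (t + 1) ^ 2) := by
      rw [mul_pow, sq_abs, ← hs2, W]; ring
    have h7 := mul_le_mul_of_nonneg_left h6 (sq_nonneg s)
    have h8 : 0 ≤ 2 * β * E₀ := mul_nonneg (by linarith) h.energy₀_nonneg
    linarith
  rcases le_total x m with hxm | hxm
  · exact h.sol₀.le_mul_exp h.pos₀ hs0 (by linarith) hq hx hm' hxm
  -- The Harnack bound runs from left to right only, so this case is reflected into the well at
  -- `-1`.
  · have hneg : ∀ t : ℝ, |-t - -1| = |t - 1| := fun t => by rw [← abs_neg]; congr 1; ring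
    have hneg' : ∀ t : ℝ, |t - -1| = |-t - 1| := fun t => by rw [← abs_neg]; congr 1; ring
    have := h.sol₀.comp_neg.le_mul_exp (c := -1) (x := -x) (y := -m) (fun t => h.pos₀ (-t)) hs0
      (by linarith : 0 < L)
      (fun t ht => by
        have hW : W (-t) = W t := by simp [W]
        rw [← hW]; exact hq (-t) (by rwa [← hneg']))
      (by rwa [hneg]) (by rwa [hneg]) (by linarith)
    simpa using this

/-- The mass `1/2` is at most `3 ψ₀ m ^ 2` before the peak plus `4 ψ₀ m ^ 2` after it. -/
lemma peak_sq_ge (h : IsHalfLinePair β E₀ E₁ ψ₀ dψ₀ ψ₁ dψ₁) (hm : IsPeak dψ₀ m) :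
    1 / 14 ≤ ψ₀ m ^ 2 := by
  have h1 : ∫ t in (0 : ℝ)..m, ψ₀ t ^ 2 ≤ ∫ t in (0 : ℝ)..m, ψ₀ m ^ 2 :=
    intervalIntegral.integral_mono_on hm.nonneg
      ((h.sol₀.continuous.pow 2).intervalIntegrable _ _) (by simp)
      fun t ht => pow_le_pow_left₀ (h.pos₀ t).le (h.le_peak hm ht.1) 2
  rw [integral_sq_eq_tail_sub_tail h.sol₀.continuous, intervalIntegral.integral_const,
    smul_eq_mul, tail_zero] at h1
  nlinarith [h.tail_le_sq hm le_rfl, hm.le_three, sq_nonneg (ψ₀ m)]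

lemma ratio_mul_tail_le_wronskian (h : IsHalfLinePair β E₀ E₁ ψ₀ dψ₀ ψ₁ dψ₁) {x : ℝ} (hx : 0 ≤ x) :
    2 * (β * (E₁ - E₀)) * ratio ψ₀ ψ₁ x * tail ψ₀ x ≤ wronskian ψ₀ dψ₀ ψ₁ dψ₁ x := by
  have hanti : AntitoneOn (fun y => wronskian ψ₀ dψ₀ ψ₁ dψ₁ y
      - 2 * (β * (E₁ - E₀)) * ratio ψ₀ ψ₁ x * tail ψ₀ y) (Set.Ici x) := by
    refine antitoneOn_of_hasDerivAt_nonpos (convex_Ici x)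
      (fun y _ => (h.hasDerivAt_wronskian y).sub ((hasDerivAt_tail h.sol₀.continuous y).const_mul
        (2 * (β * (E₁ - E₀)) * ratio ψ₀ ψ₁ x))) ?_
    intro y hy
    have h1 := h.monotoneOn_ratio hx (Set.mem_Ici.2 (hx.trans hy)) hy
    have h2 := mul_le_mul_of_nonneg_right h1 (mul_nonneg h.mul_gap_pos.le (sq_nonneg (ψ₀ y)))
    rw [← h.ratio_mul y]
    linarith
  have hlim : Tendsto (fun y => wronskian ψ₀ dψ₀ ψ₁ dψ₁ y
      - 2 * (β * (E₁ - E₀)) * ratio ψ₀ ψ₁ x * tail ψ₀ y) atTop (𝓝 0) := by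
    simpa using h.tendsto_wronskian.sub ((tendsto_tail h.mass₀).const_mul
      (2 * (β * (E₁ - E₀)) * ratio ψ₀ ψ₁ x))
  have : 0 ≤ wronskian ψ₀ dψ₀ ψ₁ dψ₁ x - 2 * (β * (E₁ - E₀)) * ratio ψ₀ ψ₁ x * tail ψ₀ x := by
    refine le_of_tendsto hlim ?_
    filter_upwards [eventually_ge_atTop x] with y hy
    exact hanti (Set.mem_Ici.2 le_rfl) hy hy
  linarith

/-- The ground state is small inside the barrier. -/
lemma half_sq_mul_le (h : IsHalfLinePair β E₀ E₁ ψ₀ dψ₀ ψ₁ dψ₁) (hm : IsPeak dψ₀ m)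
    (hβ : 200 ≤ β) (hm34 : 3 / 4 ≤ m) : ψ₀ (1 / 2) ^ 2 * β ^ 3 ≤ 819200 := by
  set p := ψ₀ (1 / 2) with hp
  have hp0 : 0 < p := h.pos₀ _
  -- On `[1/2, 3/4]` one has `W ≥ W (3/4) = 49/512`, so `β ≥ 200` gives `β W - E₀ ≥ β / 20` and
  -- `ψ₀'' ≥ (β² / 10) p`. Integrating twice yields `ψ₀ (3/4) ≥ β² p / 320`.
  have hd : MonotoneOn (fun x => dψ₀ x - β ^ 2 / 10 * p * (x - 1 / 2))
      (Set.Icc (1 / 2) (3 / 4)) := by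
    refine monotoneOn_of_hasDerivAt_nonneg (convex_Icc _ _)
      (fun x _ => (h.sol₀.hasDerivAt_deriv x).sub
      (((hasDerivAt_id x).sub_const (1 / 2)).const_mul (β ^ 2 / 10 * p))) ?_
    intro x hx
    have h1 : 49 / 512 ≤ W x := by
      have := W_antitone (by linarith [hx.1] : 0 ≤ x) hx.2 (by norm_num)
      refine le_trans ?_ this
      unfold W; norm_num
    have h2 : β / 20 ≤ β * W x - E₀ := by nlinarith [h.energy₀_le]
    have h3 : p ≤ ψ₀ x := h.monotoneOn_of_isPeak hm ⟨by norm_num, by linarith⟩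
      ⟨by linarith [hx.1], by linarith [hx.2]⟩ hx.1
    have h4 : 2 * β * (β / 20) * p ≤ 2 * β * (β * W x - E₀) * ψ₀ x := by
      have : 0 ≤ β * W x - E₀ := by linarith
      gcongr
    linarith
  have hψ : MonotoneOn (fun x => ψ₀ x - β ^ 2 / 20 * p * (x - 1 / 2) ^ 2)
      (Set.Icc (1 / 2) (3 / 4)) := by
    refine monotoneOn_of_hasDerivAt_nonneg (convex_Icc _ _) (fun x _ => (h.sol₀.hasDerivAt x).sub
      ((((hasDerivAt_id x).sub_const (1 / 2)).pow 2).const_mul (β ^ 2 / 20 * p))) ?_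
    intro x hx
    have h1 := hd (Set.left_mem_Icc.2 (by norm_num)) hx hx.1
    have h2 := hm.deriv_nonneg (1 / 2) (by norm_num) (by linarith)
    simp only [sub_self, mul_zero, sub_zero] at h1
    simp only [id, Nat.cast_ofNat, Nat.add_one_sub_one, pow_one]
    linarith
  have h1 := hψ (Set.left_mem_Icc.2 (by norm_num)) (Set.right_mem_Icc.2 (by norm_num))
    (by norm_num : (1 / 2 : ℝ) ≤ 3 / 4)
  simp only [sub_self] at h1
  have h2 : p * β ^ 2 ≤ 320 * ψ₀ m := by
    have := h.le_peak hm (x := 3 / 4) (by norm_num)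
    linarith
  have h3 := pow_le_pow_left₀ (by positivity) h2 2
  have h4 : ψ₀ m ^ 2 ≤ 8 * β := by
    have : Real.sqrt β ≤ β := Real.sqrt_le_iff.2 ⟨by linarith, by nlinarith⟩
    linarith [h.peak_sq_le hm]
  have h5 : (p ^ 2 * β ^ 3) * β ≤ 819200 * β := by
    have e : (p * β ^ 2) ^ 2 = (p ^ 2 * β ^ 3) * β := by ring
    rw [← e]
    linarith
  exact le_of_mul_le_mul_right h5 (by linarith)

/-- With `p = ψ₀ (1/2)`, on `[0, 1/2]` one has `r' ≥ w (1/2) / p²`, so `p² r (1/2) ≥ w (1/2) / 2`.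
As also `w (1/2) ≥ 2 ε r (1/2) tail ψ₀ (1/2)`, the factor `r (1/2)` cancels and `ε ≤ 4 p²`. The rate
is crude; only convergence to `0` matters later. -/
lemma mul_gap_le (h : IsHalfLinePair β E₀ E₁ ψ₀ dψ₀ ψ₁ dψ₁) (hβ : 200 ≤ β) :
    β * (E₁ - E₀) ≤ 3276800 / β := by
  obtain ⟨m, hm⟩ := h.exists_isPeak
  have hm34 : 3 / 4 ≤ m := by
    have := h.mul_peak_sub_one_sq_le hm
    by_contra! hlt
    nlinarith
  have hp := h.half_sq_mul_le hm hβ hm34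
  have hmono := h.monotoneOn_of_isPeak hm
  set p := ψ₀ (1 / 2) with hpdef
  have hp0 : 0 < p := h.pos₀ _
  have hpβ : p ^ 2 ≤ 819200 / β := by
    rw [le_div_iff₀ (by linarith)]
    refine le_trans ?_ hp
    gcongr
    exact le_self_pow₀ (by linarith) (by norm_num)
  have hp1 : p ^ 2 ≤ 1 / 2 := by
    have : (200 : ℝ) ^ 3 ≤ β ^ 3 := by gcongr
    nlinarith [sq_nonneg p]
  have hle : ∀ x ∈ Set.Icc (0 : ℝ) (1 / 2), ψ₀ x ^ 2 ≤ p ^ 2 := fun x hx =>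
    pow_le_pow_left₀ (h.pos₀ x).le (hmono ⟨hx.1, by linarith [hx.2]⟩ ⟨by norm_num, by linarith⟩ hx.2) 2
  have htail : 1 / 4 ≤ tail ψ₀ (1 / 2) := by
    have h1 : ∫ t in (0 : ℝ)..(1 / 2), ψ₀ t ^ 2 ≤ ∫ t in (0 : ℝ)..(1 / 2), p ^ 2 :=
      intervalIntegral.integral_mono_on (by norm_num)
        ((h.sol₀.continuous.pow 2).intervalIntegrable _ _) (by simp) hle
    rw [integral_sq_eq_tail_sub_tail h.sol₀.continuous, intervalIntegral.integral_const,
      smul_eq_mul, tail_zero] at h1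
    linarith
  have hr : MonotoneOn (fun y => p ^ 2 * ratio ψ₀ ψ₁ y - wronskian ψ₀ dψ₀ ψ₁ dψ₁ (1 / 2) * y)
      (Set.Icc 0 (1 / 2)) := by
    refine monotoneOn_of_hasDerivAt_nonneg (convex_Icc _ _)
      (fun y _ => ((h.hasDerivAt_ratio y).const_mul (p ^ 2)).sub
        ((hasDerivAt_id y).const_mul (wronskian ψ₀ dψ₀ ψ₁ dψ₁ (1 / 2)))) ?_
    intro y hy
    have h1 := h.antitoneOn_wronskian hy.1 (Set.mem_Ici.2 (by norm_num : (0 : ℝ) ≤ 1 / 2)) hy.2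
    have h2 := hle y hy
    have h3 : 0 < ψ₀ y ^ 2 := pow_pos (h.pos₀ y) 2
    have h4 := h.wronskian_nonneg hy.1
    have h5 : wronskian ψ₀ dψ₀ ψ₁ dψ₁ y ≤ p ^ 2 * (wronskian ψ₀ dψ₀ ψ₁ dψ₁ y / ψ₀ y ^ 2) := by
      rw [← mul_div_assoc, le_div_iff₀ h3]; nlinarith
    linarith
  have h1 := hr (Set.left_mem_Icc.2 (by norm_num)) (Set.right_mem_Icc.2 (by norm_num))
    (by norm_num : (0 : ℝ) ≤ 1 / 2)
  have hr0 : ratio ψ₀ ψ₁ 0 = 0 := by simp [ratio, h.zero]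
  simp only [hr0, mul_zero, sub_zero] at h1
  have h2 := h.ratio_mul_tail_le_wronskian (x := 1 / 2) (by norm_num)
  have hrpos : 0 < ratio ψ₀ ψ₁ (1 / 2) := div_pos (h.pos₁ _ (by norm_num)) (h.pos₀ _)
  have h3 : (β * (E₁ - E₀) * tail ψ₀ (1 / 2)) * ratio ψ₀ ψ₁ (1 / 2)
      ≤ p ^ 2 * ratio ψ₀ ψ₁ (1 / 2) := by linarith
  have h4 := le_of_mul_le_mul_right h3 hrpos
  have h5 := mul_le_mul_of_nonneg_left htail h.mul_gap_pos.le
  have e : 3276800 / β = 4 * (819200 / β) := by ring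
  rw [e]
  linarith

end IsHalfLinePair
end DoubleWell

/-! ### Asymptotics of the gap, part (b). -/

namespace DoubleWell
namespace IsHalfLinePair

variable {β E₀ E₁ m : ℝ} {ψ₀ dψ₀ ψ₁ dψ₁ : ℝ → ℝ}

lemma wronskian_zero_le (h : IsHalfLinePair β E₀ E₁ ψ₀ dψ₀ ψ₁ dψ₁) :
    wronskian ψ₀ dψ₀ ψ₁ dψ₁ 0 ≤ β * (E₁ - E₀) := by
  have := h.wronskian_le_tail 0
  rw [tail_zero, tail_zero] at this
  linarith

/-- In `w 0 = 2 ε ∫ r ψ₀²` replace `r` by `r m`: beyond `m` this only decreases the integral, and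
before `m ≤ 3` it costs at most `24 ε²`. With `r m ≥ 1 - 64 ε` the total loss is `88 ε²`. -/
lemma le_wronskian_zero (h : IsHalfLinePair β E₀ E₁ ψ₀ dψ₀ ψ₁ dψ₁) :
    (1 - 88 * (β * (E₁ - E₀))) * (β * (E₁ - E₀)) ≤ wronskian ψ₀ dψ₀ ψ₁ dψ₁ 0 := by
  obtain ⟨m, hm⟩ := h.exists_isPeak
  have hε := h.mul_gap_pos
  set ε := β * (E₁ - E₀) with hεdef
  have hanti : AntitoneOn (fun y => wronskian ψ₀ dψ₀ ψ₁ dψ₁ y - 2 * ε * ratio ψ₀ ψ₁ m * tail ψ₀ y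
      - 8 * ε ^ 2 * y) (Set.Icc 0 m) := by
    refine antitoneOn_of_hasDerivAt_nonpos (convex_Icc 0 m)
      (fun y _ => ((h.hasDerivAt_wronskian y).sub ((hasDerivAt_tail h.sol₀.continuous y).const_mul
        (2 * ε * ratio ψ₀ ψ₁ m))).sub ((hasDerivAt_id y).const_mul (8 * ε ^ 2))) ?_
    intro y hy
    have h1 := h.sq_mul_abs_ratio_sub_le hm hy.1
    have h2 := mul_le_mul_of_nonneg_left
      (neg_abs_le (ratio ψ₀ ψ₁ y - ratio ψ₀ ψ₁ m)) (sq_nonneg (ψ₀ y))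
    have h3 : ψ₀ y ^ 2 * (ratio ψ₀ ψ₁ m - ratio ψ₀ ψ₁ y) ≤ 4 * ε := by linarith
    have h4 := mul_le_mul_of_nonneg_left h3 hε.le
    rw [← h.ratio_mul y, mul_assoc 2 β, ← hεdef]
    linarith
  have h1 := hanti (Set.left_mem_Icc.2 hm.nonneg) (Set.right_mem_Icc.2 hm.nonneg) hm.nonneg
  simp only [tail_zero, mul_zero, sub_zero] at h1
  have h2 := h.ratio_mul_tail_le_wronskian hm.nonneg
  have h3 := (abs_le.1 (h.abs_one_sub_ratio_peak_le hm)).2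
  rw [← hεdef] at h2 h3
  have h4 := mul_le_mul_of_nonneg_left hm.le_three (by positivity : 0 ≤ 8 * ε ^ 2)
  have h5 := mul_le_mul_of_nonneg_left h3 hε.le
  linarith

lemma abs_ratio_sub_one_le (h : IsHalfLinePair β E₀ E₁ ψ₀ dψ₀ ψ₁ dψ₁) {L x : ℝ}
    (hL : 4 ≤ L) (hβL : 2 * L ≤ Real.sqrt β) (hx0 : 0 ≤ x) (hx : Real.sqrt β * |x - 1| ≤ L) :
    |ratio ψ₀ ψ₁ x - 1| ≤ (56 * Real.exp (12 * L ^ 2 + 2) ^ 2 + 64) * (β * (E₁ - E₀)) := by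
  obtain ⟨m, hm⟩ := h.exists_isPeak
  have h1 := h.sq_mul_abs_ratio_sub_le hm hx0
  have h2 := h.abs_one_sub_ratio_peak_le hm
  have h3 := pow_le_pow_left₀ (h.pos₀ m).le (h.peak_le_exp_mul hm hL hβL hx) 2
  have h4 := h.peak_sq_ge hm
  set D := Real.exp (12 * L ^ 2 + 2)
  -- Harnack carries the lower bound `1/14` at the peak to `x`; hence `56 = 14 * 4`.
  have h5 : 1 ≤ 14 * D ^ 2 * ψ₀ x ^ 2 := by nlinarith
  have h6 : |ratio ψ₀ ψ₁ x - ratio ψ₀ ψ₁ m| ≤ 56 * D ^ 2 * (β * (E₁ - E₀)) := by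
    have := mul_le_mul_of_nonneg_right h5 (abs_nonneg (ratio ψ₀ ψ₁ x - ratio ψ₀ ψ₁ m))
    have := mul_le_mul_of_nonneg_left h1 (by positivity : 0 ≤ 14 * D ^ 2)
    linarith
  have h7 := abs_sub_le (ratio ψ₀ ψ₁ x) (ratio ψ₀ ψ₁ m) 1
  rw [abs_sub_comm (ratio ψ₀ ψ₁ m) 1] at h7
  linarith

/-- To the left of the bottom of the well the Wronskian is almost constant relative to `ψ₀²`. -/
lemma wronskian_zero_le_add (h : IsHalfLinePair β E₀ E₁ ψ₀ dψ₀ ψ₁ dψ₁) {L y : ℝ}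
    (hL : 4 ≤ L) (hβL : 2 * L ≤ Real.sqrt β) (hy0 : 0 ≤ y) (hy1 : y ≤ 1) :
    wronskian ψ₀ dψ₀ ψ₁ dψ₁ 0 ≤ wronskian ψ₀ dψ₀ ψ₁ dψ₁ y
      + 2 * (β * (E₁ - E₀)) * Real.exp (12 * L ^ 2 + 2) ^ 2 * ratio ψ₀ ψ₁ y * ψ₀ y ^ 2 := by
  obtain ⟨m, hm⟩ := h.exists_isPeak
  have hε := h.mul_gap_pos
  have hD1 : 1 ≤ Real.exp (12 * L ^ 2 + 2) := Real.one_le_exp (by positivity)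
  -- Left of the peak this is monotonicity. Otherwise `m ≤ y ≤ 1`, so `y` is at least as close to
  -- `1` as the peak is, and Harnack applies.
  have hcomp : ∀ z ∈ Set.Icc 0 y, ψ₀ z ≤ Real.exp (12 * L ^ 2 + 2) * ψ₀ y := by
    intro z hz
    rcases le_total y m with hym | hym
    · have h1 := h.monotoneOn_of_isPeak hm ⟨hz.1, hz.2.trans hym⟩ ⟨hy0, hym⟩ hz.2
      exact h1.trans (le_mul_of_one_le_left (h.pos₀ y).le hD1)
    · refine (h.le_peak hm hz.1).trans (h.peak_le_exp_mul hm hL hβL ?_)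
      refine le_trans ?_ ((h.sqrt_mul_abs_peak_sub_one_le hm).trans hL)
      gcongr 1
      rw [abs_of_nonpos (by linarith), abs_of_nonpos (by linarith)]
      linarith
  set D := Real.exp (12 * L ^ 2 + 2)
  set ε := β * (E₁ - E₀) with hεdef
  have hmono : MonotoneOn (fun z => wronskian ψ₀ dψ₀ ψ₁ dψ₁ z
      + 2 * ε * D ^ 2 * ratio ψ₀ ψ₁ y * ψ₀ y ^ 2 * z) (Set.Icc 0 y) := by
    refine monotoneOn_of_hasDerivAt_nonneg (convex_Icc 0 y)
      (fun z _ => (h.hasDerivAt_wronskian z).add ((hasDerivAt_id z).const_mul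
        (2 * ε * D ^ 2 * ratio ψ₀ ψ₁ y * ψ₀ y ^ 2))) ?_
    intro z hz
    have h1 := pow_le_pow_left₀ (h.pos₀ z).le (hcomp z hz) 2
    have h2 := h.monotoneOn_ratio hz.1 hy0 hz.2
    have h3 : ratio ψ₀ ψ₁ z * ψ₀ z ^ 2 ≤ ratio ψ₀ ψ₁ y * (D * ψ₀ y) ^ 2 :=
      mul_le_mul h2 h1 (sq_nonneg _) (h.ratio_nonneg hy0)
    have h4 := mul_le_mul_of_nonneg_left h3 hε.le
    rw [← h.ratio_mul z, mul_assoc 2 β, ← hεdef]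
    linarith
  have h1 := hmono (Set.left_mem_Icc.2 hy0) (Set.right_mem_Icc.2 hy0) hy0
  simp only [mul_zero, add_zero] at h1
  have h2 : 0 ≤ 2 * ε * D ^ 2 * ratio ψ₀ ψ₁ y * ψ₀ y ^ 2 := by
    have := h.ratio_nonneg hy0
    positivity
  nlinarith

lemma integral_wronskian_div_sq (h : IsHalfLinePair β E₀ E₁ ψ₀ dψ₀ ψ₁ dψ₁) (x : ℝ) :
    ∫ y in (0 : ℝ)..x, wronskian ψ₀ dψ₀ ψ₁ dψ₁ y / ψ₀ y ^ 2 = ratio ψ₀ ψ₁ x := by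
  have c := h.continuous_wronskian
  have c0 := h.sol₀.continuous
  rw [intervalIntegral.integral_eq_sub_of_hasDerivAt (fun y _ => h.hasDerivAt_ratio y)
    (Continuous.intervalIntegrable
      (c.div (c0.pow 2) fun y => (pow_pos (h.pos₀ y) 2).ne') _ _)]
  simp [ratio, h.zero]

/-- Two-sided bounds on `β (E₁ - E₀) / κ`. -/
theorem gap_mul_integral_bounds (h : IsHalfLinePair β E₀ E₁ ψ₀ dψ₀ ψ₁ dψ₁) {χ : ℝ → ℝ}
    (hχ : IsCutoffProfile χ) {L δ : ℝ} (hL : 4 ≤ L) (hβL : 2 * L ≤ Real.sqrt β) (hδ : 0 < δ)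
    (hδL : Real.sqrt β * (2 * δ) ≤ L) :
    let ε := β * (E₁ - E₀)
    let D := Real.exp (12 * L ^ 2 + 2)
    let K := 56 * D ^ 2 + 64
    let S := ∫ y in (0 : ℝ)..1, χ ((|y| - 1) / δ) / ψ₀ y ^ 2
    1 - K * ε ≤ ε * S ∧ (1 - 88 * ε) * (ε * S) ≤ (1 + K * ε) * (1 + 2 * ε * D ^ 2) := by
  intro ε D K S
  have hε : 0 < ε := h.mul_gap_pos
  have hs0 : 0 < Real.sqrt β := by linarith
  have hδ1 : 2 * δ ≤ 1 / 2 := by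
    have : Real.sqrt β * (2 * δ) ≤ Real.sqrt β * (1 / 2) := by linarith
    exact le_of_mul_le_mul_left this hs0
  have c := h.continuous_wronskian
  have c0 := h.sol₀.continuous
  have cχ := hχ.smooth.continuous
  have hne : ∀ y, ψ₀ y ^ 2 ≠ 0 := fun y => (pow_pos (h.pos₀ y) 2).ne'
  have cη : Continuous fun y : ℝ => χ ((|y| - 1) / δ) := by fun_prop
  have hη1 : ∀ y, 0 ≤ y → y ≤ 1 - 2 * δ → χ ((|y| - 1) / δ) = 1 := fun y h0 h1 => by
    refine hχ.eq_one _ ?_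
    rw [abs_of_nonneg h0, div_le_iff₀ hδ]; linarith
  have hη0 : ∀ y, 0 ≤ y → 1 - δ ≤ y → χ ((|y| - 1) / δ) = 0 := fun y h0 h1 => by
    refine hχ.eq_zero _ ?_
    rw [abs_of_nonneg h0, le_div_iff₀ hδ]; linarith
  set w := wronskian ψ₀ dψ₀ ψ₁ dψ₁ with hw
  have cr : Continuous fun y => w y / ψ₀ y ^ 2 := c.div (c0.pow 2) hne
  have cS : Continuous fun y => χ ((|y| - 1) / δ) / ψ₀ y ^ 2 := cη.div (c0.pow 2) hne
  have cJ : Continuous fun y => χ ((|y| - 1) / δ) * (w y / ψ₀ y ^ 2) := cη.mul cr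
  -- `J` is a cut-off integral of `r'`, so it lies between `r (1 - 2 δ)` and `r (1 - δ)`, both `1 +
  -- O(ε)`. It differs from `w 0 * S` only in that `w` is not frozen at `0`.
  set J := ∫ y in (0 : ℝ)..1, χ ((|y| - 1) / δ) * (w y / ψ₀ y ^ 2) with hJ
  have hr0 : ∀ y, 0 ≤ y → 0 ≤ w y / ψ₀ y ^ 2 := fun y hy =>
    div_nonneg (h.wronskian_nonneg hy) (sq_nonneg _)
  have hJ1 : ratio ψ₀ ψ₁ (1 - 2 * δ) ≤ J := by
    rw [← h.integral_wronskian_div_sq, hJ, ← intervalIntegral.integral_add_adjacent_intervals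
      (cJ.intervalIntegrable 0 (1 - 2 * δ)) (cJ.intervalIntegrable (1 - 2 * δ) 1)]
    have e : ∫ y in (0 : ℝ)..(1 - 2 * δ), χ ((|y| - 1) / δ) * (w y / ψ₀ y ^ 2)
        = ∫ y in (0 : ℝ)..(1 - 2 * δ), w y / ψ₀ y ^ 2 := by
      refine intervalIntegral.integral_congr fun y hy => ?_
      rw [Set.uIcc_of_le (by linarith)] at hy
      simp only [hη1 y hy.1 hy.2, one_mul]
    rw [e, le_add_iff_nonneg_right]
    exact intervalIntegral.integral_nonneg (by linarith) fun y hy =>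
      mul_nonneg (hχ.nonneg _) (hr0 y (by linarith [hy.1]))
  have hJ2 : J ≤ ratio ψ₀ ψ₁ (1 - δ) := by
    rw [← h.integral_wronskian_div_sq, hJ, ← intervalIntegral.integral_add_adjacent_intervals
      (cJ.intervalIntegrable 0 (1 - δ)) (cJ.intervalIntegrable (1 - δ) 1)]
    have e : ∫ y in (1 - δ)..1, χ ((|y| - 1) / δ) * (w y / ψ₀ y ^ 2) = 0 := by
      rw [intervalIntegral.integral_congr (g := fun _ => (0 : ℝ)) fun y hy => ?_]
      · simp
      · rw [Set.uIcc_of_le (by linarith)] at hy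
        simp only [hη0 y (by linarith [hy.1]) hy.1, zero_mul]
    rw [e, add_zero]
    refine intervalIntegral.integral_mono_on (by linarith) (cJ.intervalIntegrable _ _)
      (cr.intervalIntegrable _ _) fun y hy => ?_
    exact mul_le_of_le_one_left (hr0 y hy.1) (hχ.le_one _)
  have hx1 := h.abs_ratio_sub_one_le hL hβL (x := 1 - 2 * δ) (by linarith) (by
    rw [show 1 - 2 * δ - 1 = -(2 * δ) by ring, abs_neg, abs_of_pos (by linarith)]; exact hδL)
  have hx2 := h.abs_ratio_sub_one_le hL hβL (x := 1 - δ) (by linarith) (by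
    rw [show 1 - δ - 1 = -δ by ring, abs_neg, abs_of_pos hδ]; nlinarith)
  change _ ≤ K * ε at hx1 hx2
  have hr1 := (abs_le.1 hx1).1
  have hr2 := (abs_le.1 hx2).2
  have hSnn : 0 ≤ S := intervalIntegral.integral_nonneg zero_le_one fun y _ =>
    div_nonneg (hχ.nonneg _) (sq_nonneg _)
  have hJle : J ≤ w 0 * S := by
    rw [hJ, ← intervalIntegral.integral_const_mul]
    refine intervalIntegral.integral_mono_on zero_le_one (cJ.intervalIntegrable _ _)
      ((cS.const_mul _).intervalIntegrable _ _) fun y hy => ?_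
    have h1 := h.antitoneOn_wronskian (Set.mem_Ici.2 le_rfl) hy.1 hy.1
    have h2 : 0 ≤ χ ((|y| - 1) / δ) / ψ₀ y ^ 2 := div_nonneg (hχ.nonneg _) (sq_nonneg _)
    calc χ ((|y| - 1) / δ) * (w y / ψ₀ y ^ 2) = w y * (χ ((|y| - 1) / δ) / ψ₀ y ^ 2) := by ring
      _ ≤ _ := mul_le_mul_of_nonneg_right h1 h2
  have hJge : w 0 * S ≤ J + 2 * ε * D ^ 2 * (1 + K * ε) := by
    have hconst : ∫ y in (0 : ℝ)..1, 2 * ε * D ^ 2 * (1 + K * ε) = 2 * ε * D ^ 2 * (1 + K * ε) := by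
      simp
    rw [hJ, ← intervalIntegral.integral_const_mul, ← hconst,
      ← intervalIntegral.integral_add (cJ.intervalIntegrable _ _) (by simp)]
    refine intervalIntegral.integral_mono_on zero_le_one ((cS.const_mul _).intervalIntegrable _ _)
      ((cJ.add continuous_const).intervalIntegrable _ _) fun y hy => ?_
    have hbd : 0 ≤ 2 * ε * D ^ 2 * (1 + K * ε) := by
      have : 0 ≤ K := by positivity
      positivity
    rcases le_total (1 - δ) y with hyδ | hyδ
    · rw [hη0 y hy.1 hyδ]
      simpa using hbd
    · have h1 := h.wronskian_zero_le_add hL hβL hy.1 hy.2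
      have h2 := h.monotoneOn_ratio hy.1 (Set.mem_Ici.2 (by linarith : 0 ≤ 1 - δ)) hyδ
      have h3 : 0 < ψ₀ y ^ 2 := pow_pos (h.pos₀ y) 2
      have h4 : w 0 / ψ₀ y ^ 2 ≤ w y / ψ₀ y ^ 2 + 2 * ε * D ^ 2 * (1 + K * ε) := by
        rw [div_le_iff₀ h3, add_mul, div_mul_cancel₀ _ h3.ne']
        refine h1.trans ?_
        gcongr
        linarith
      have h5 := mul_le_mul_of_nonneg_left h4 (hχ.nonneg ((|y| - 1) / δ))
      have h6 := mul_le_of_le_one_left hbd (hχ.le_one ((|y| - 1) / δ))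
      calc w 0 * (χ ((|y| - 1) / δ) / ψ₀ y ^ 2) = χ ((|y| - 1) / δ) * (w 0 / ψ₀ y ^ 2) := by ring
        _ ≤ _ := by linarith
  -- Finally `w 0` is exchanged for `ε`, using `(1 - 88 ε) ε ≤ w 0 ≤ ε`.
  have hw1 := mul_le_mul_of_nonneg_right h.wronskian_zero_le hSnn
  have hw2 := mul_le_mul_of_nonneg_right h.le_wronskian_zero hSnn
  constructor
  · linarith
  · linarith

end IsHalfLinePair

/-- `β (E₁ - E₀) ∫ χ_δ / ψ₀² → 1` as `β → ∞`. -/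
theorem tendsto_gap_mul_integral {χ : ℝ → ℝ} {c : ℝ} (hχ : IsCutoffProfile χ) (hc : 0 < c)
    {E₀ E₁ : ℝ → ℝ} {ψ₀ ψ₁ : ℝ → ℝ → ℝ}
    (h : ∀ β : ℝ, 1 ≤ β → IsFirstTwoEigenpairs β (E₀ β) (E₁ β) (ψ₀ β) (ψ₁ β)) :
    Tendsto (fun β : ℝ => β * (E₁ β - E₀ β)
      * ∫ y in (0 : ℝ)..1, χ ((|y| - 1) / (c / Real.sqrt β)) / ψ₀ β y ^ 2) atTop (𝓝 1) := by
  -- The `4` makes the window contain the peak; the `2 c` makes it contain the transition zone of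
  -- the cutoff, since `√β * 2 δ = 2 c`.
  set L := max 4 (2 * c)
  set D := Real.exp (12 * L ^ 2 + 2)
  set K := 56 * D ^ 2 + 64
  have hε : Tendsto (fun β : ℝ => β * (E₁ β - E₀ β)) atTop (𝓝 0) := by
    refine tendsto_of_tendsto_of_tendsto_of_le_of_le' tendsto_const_nhds
      (tendsto_const_nhds.div_atTop tendsto_id : Tendsto (fun β : ℝ => 3276800 / β) atTop (𝓝 0)) ?_ ?_
    · filter_upwards [eventually_ge_atTop 1] with β hβ
      obtain ⟨_, _, hp⟩ := (h β hβ).exists_isHalfLinePair hβ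
      exact hp.mul_gap_pos.le
    · filter_upwards [eventually_ge_atTop 200] with β hβ
      obtain ⟨_, _, hp⟩ := (h β (by linarith)).exists_isHalfLinePair (by linarith)
      exact hp.mul_gap_le hβ
  have hlow : Tendsto (fun β : ℝ => 1 - K * (β * (E₁ β - E₀ β))) atTop (𝓝 1) := by
    simpa using (hε.const_mul K).const_sub 1
  have hden : Tendsto (fun β : ℝ => 1 - 88 * (β * (E₁ β - E₀ β))) atTop (𝓝 1) := by
    simpa using (hε.const_mul 88).const_sub 1
  have hup : Tendsto (fun β : ℝ => (1 + K * (β * (E₁ β - E₀ β)))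
      * (1 + 2 * (β * (E₁ β - E₀ β)) * D ^ 2) / (1 - 88 * (β * (E₁ β - E₀ β)))) atTop (𝓝 1) := by
    have := (((hε.const_mul K).const_add 1).mul
      (((hε.const_mul 2).mul_const (D ^ 2)).const_add 1)).div hden one_ne_zero
    simp only [mul_zero, zero_mul, add_zero, mul_one, div_one] at this
    exact this
  have hev : ∀ᶠ β in atTop, 2 * L ≤ Real.sqrt β :=
    Real.tendsto_sqrt_atTop.eventually_ge_atTop _
  have hb : ∀ᶠ β : ℝ in atTop, 1 ≤ β ∧ 2 * L ≤ Real.sqrt β := (eventually_ge_atTop 1).and hev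
  have key : ∀ᶠ β : ℝ in atTop,
      1 - K * (β * (E₁ β - E₀ β)) ≤ β * (E₁ β - E₀ β)
        * ∫ y in (0 : ℝ)..1, χ ((|y| - 1) / (c / Real.sqrt β)) / ψ₀ β y ^ 2 ∧
      (1 - 88 * (β * (E₁ β - E₀ β))) * (β * (E₁ β - E₀ β)
        * ∫ y in (0 : ℝ)..1, χ ((|y| - 1) / (c / Real.sqrt β)) / ψ₀ β y ^ 2)
        ≤ (1 + K * (β * (E₁ β - E₀ β))) * (1 + 2 * (β * (E₁ β - E₀ β)) * D ^ 2) := by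
    filter_upwards [hb] with β hβ
    obtain ⟨_, _, hp⟩ := (h β hβ.1).exists_isHalfLinePair hβ.1
    have hs : 0 < Real.sqrt β := Real.sqrt_pos.2 (by linarith [hβ.1])
    refine hp.gap_mul_integral_bounds hχ (le_max_left _ _) hβ.2 (by positivity) ?_
    have e : Real.sqrt β * (2 * (c / Real.sqrt β)) = 2 * c := by field_simp
    rw [e]; exact le_max_right _ _
  refine tendsto_of_tendsto_of_tendsto_of_le_of_le' hlow hup (key.mono fun β hβ => hβ.1) ?_
  filter_upwards [key, hden.eventually_const_lt zero_lt_one] with β hβ hpos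
  rw [le_div_iff₀ hpos, mul_comm]
  exact hβ.2

end DoubleWell

theorem theorem3p4 :
    (∃ C : ℝ, 0 < C ∧ ∀ β : ℝ, 1 ≤ β → ∀ (E₀ E₁ : ℝ) (ψ₀ ψ₁ : ℝ → ℝ),
      DoubleWell.IsFirstTwoEigenpairs β E₀ E₁ ψ₀ ψ₁ →
        ∀ x : ℝ, 0 ≤ x → ψ₀ x * |ψ₀ x - ψ₁ x| ≤ C * β ^ (3 / 2 : ℝ) * (E₁ - E₀)) ∧
    (∀ (χ : ℝ → ℝ) (c : ℝ), DoubleWell.IsCutoffProfile χ → 0 < c →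
      ∀ (E₀ E₁ : ℝ → ℝ) (ψ₀ ψ₁ : ℝ → ℝ → ℝ),
        (∀ β : ℝ, 1 ≤ β → DoubleWell.IsFirstTwoEigenpairs β (E₀ β) (E₁ β) (ψ₀ β) (ψ₁ β)) →
          (fun β : ℝ => β * (E₁ β - E₀ β)) ~[atTop]
            fun β : ℝ => DoubleWell.kappa χ (c / Real.sqrt β) (ψ₀ β)) := by
  refine ⟨⟨516, by norm_num, fun β hβ E₀ E₁ ψ₀ ψ₁ h x hx => ?_⟩, ?_⟩
  · obtain ⟨_, _, hp⟩ := h.exists_isHalfLinePair hβ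
    exact hp.mul_abs_sub_le hx
  · intro χ c hχ hc E₀ E₁ ψ₀ ψ₁ h
    refine isEquivalent_of_tendsto_one ?_
    refine (DoubleWell.tendsto_gap_mul_integral hχ hc h).congr fun β => ?_
    rw [Pi.div_apply, DoubleWell.kappa, div_inv_eq_mul]
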